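/- Let $\Omega\subset\mathbb{C}^n$ be a smooth bounded pseudoconvex domain and $\rho$ a defining function for $\Omega$ (a real function that is $C^\infty$ in a neighborhood $U$ of $\overline\Omega$, with $\Omega=\{z\in U:\rho(z)<0\}$ and $\nabla\rho\neq 0$ on $b\Omega$). For a $(0,q)$-form $u=\sum'_{|J|=q}u_J\,d\overline{z}_J$ the coefficients $u_J$ are extended to all $q$-tuples by antisymmetry; $\|\cdot\|$ is the norm of $L^2_{(0,q)}(\Omega)$, $\|\cdot\|_{-1}$ the norm of $W^{-1}_{(0,q)}(\Omega)$ (the dual of $W^1_0$, coefficientwise), and $\overline\partial^*$ is the Hilbert space adjoint of the maximal (weak) $\overline\partial$ on $L^2$-forms. For $C\in\mathbb{R}$ and $1\le q\le n$, say that a family $\{\rho_\epsilon\}_{\epsilon>0}$ of defining functions for $\Omega$ satisfies the conditions at level $q$ with constant $C$ if for every $\epsilon>0$ (i) $1/C<|\nabla\rho_\epsilon|<C$ on $b\Omega$, and (ii) there is a constant $C_\epsilon$ with $$\Big\|\sum_{|K|=q-1}{}^{\!\!\!\prime}\Big(\sum_{j,k=1}^n\frac{\partial^2\rho_\epsilon}{\partial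 z_j\partial\overline{z}_k}\frac{\partial\rho}{\partial\overline{z}_j}\overline{u_{kK}}\Big)d\overline{z}_K\Big\|^2\le\epsilon\big(\|\overline\partial u\|^2+\|\overline\partial^*u\|^2\big)+C_\epsilon\|u\|_{-1}^2$$ for all $u\in C^\infty_{(0,q)}(\overline\Omega)\cap\mathrm{dom}(\overline\partial^*)$. Let $1\le q\le n-1$. Then: (a) If there is a constant $C$ such that for every $\epsilon>0$ there are a defining function $\rho_\epsilon$ and a constant $C_\epsilon$ with (i) and (ii) at level $q$, then the same holds at level $q+1$. (b) The same family works up to rescaling: there is $A>0$ such that, for every $C$, whenever a family $\{\rho_\epsilon\}_{\epsilon>0}$ satisfies the conditions at level $q$ with constant $C$, the family $\{\rho_{\epsilon/A}\}_{\epsilon>0}$ satisfies the conditions at level $q+1$ with constant $C$. (c) There is a constant $B$ such that for every $u\in C^\infty_{(0,q+1)}(\overline\Omega)\cap\mathrm{dom}(\overline\partial^*)$ and every $1\le k\le n$, the form $v_k=\sum'_{|K|=q}u_{kK}\,d\overline{z}_K$ belongs to $C^\infty_{(0,q)}(\overline\Omega)\cap\mathrm{dom}(\overline\partial^*)$, and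 $\|\overline\partial^*v_k\|\le\|\overline\partial^*u\|$ and $\|\overline\partial v_k\|^2\le B\big(\|\overline\partial u\|^2+\|\overline\partial^*u\|^2\big)$. -/

import Mathlib

open MeasureTheory
open scoped ContDiff InnerProductSpace ComplexConjugate

/-! Differential calculus on `ℂⁿ`. -/

/-- `ℂⁿ` with its Euclidean norm and Lebesgue measure. -/
abbrev Cn (n : ℕ) : Type := EuclideanSpace ℂ (Fin n)

/-- The Wirtinger derivative `∂f/∂z_j = (1/2)(∂f/∂x_j - i ∂f/∂y_j)`. -/
noncomputable def dz {n : ℕ} (j : Fin n) (f : Cn n → ℂ) (z : Cn n) : ℂ :=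
  (1 / 2 : ℂ) * (fderiv ℝ f z (EuclideanSpace.single j 1)
    - Complex.I * fderiv ℝ f z (EuclideanSpace.single j Complex.I))

/-- The Wirtinger derivative `∂f/∂z̄_j = (1/2)(∂f/∂x_j + i ∂f/∂y_j)`. -/
noncomputable def dzbar {n : ℕ} (j : Fin n) (f : Cn n → ℂ) (z : Cn n) : ℂ :=
  (1 / 2 : ℂ) * (fderiv ℝ f z (EuclideanSpace.single j 1)
    + Complex.I * fderiv ℝ f z (EuclideanSpace.single j Complex.I))

/-- A real-valued function regarded as complex-valued. -/
def toComplex {n : ℕ} (ρ : Cn n → ℝ) : Cn n → ℂ := fun z => (ρ z : ℂ)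

/-- The entry `∂²ρ/∂z_j∂z̄_k` of the complex Hessian of `ρ`. -/
noncomputable def complexHessian {n : ℕ} (ρ : Cn n → ℝ) (j k : Fin n) (z : Cn n) : ℂ :=
  dz j (dzbar k (toComplex ρ)) z

/-! Smooth bounded pseudoconvex domains. -/

/-- `ρ` is a (smooth) defining function for `Ω`: it is smooth in a neighbourhood `U` of the closure
of `Ω`, `Ω = {z ∈ U | ρ z < 0}`, and its gradient does not vanish on the boundary of `Ω`. -/
def IsDefiningFunction {n : ℕ} (Ω : Set (Cn n)) (ρ : Cn n → ℝ) : Prop :=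
  (∃ U : Set (Cn n), IsOpen U ∧ closure Ω ⊆ U ∧ ContDiffOn ℝ ∞ ρ U ∧ Ω = {z ∈ U | ρ z < 0}) ∧
    ∀ z ∈ frontier Ω, gradient ρ z ≠ 0

/-- The Levi form of `ρ` is nonnegative on the complex tangent space at each boundary point. -/
def IsLeviPseudoconvex {n : ℕ} (Ω : Set (Cn n)) (ρ : Cn n → ℝ) : Prop :=
  ∀ z ∈ frontier Ω, ∀ w : Fin n → ℂ, ∑ j, dz j (toComplex ρ) z * w j = 0 →
    0 ≤ (∑ j, ∑ k, complexHessian ρ j k z * w j * conj (w k)).re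

/-- `Ω` is a smooth bounded pseudoconvex domain in `ℂⁿ`. -/
structure IsSmoothBoundedPseudoconvexDomain {n : ℕ} (Ω : Set (Cn n)) : Prop where
  isOpen : IsOpen Ω
  isConnected : IsConnected Ω
  isBounded : Bornology.IsBounded Ω
  pseudoconvex : ∃ r : Cn n → ℝ, IsDefiningFunction Ω r ∧ IsLeviPseudoconvex Ω r

/-! Forms of type `(0,q)`. -/

/-- The space of values of the forms `u = ∑_I u_I dz̄_I`, where `I` runs over the subsets of
`{1, …, n}`, that is, over the increasing tuples; the `dz̄_I` are orthonormal.  The form has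
type `(0,q)` if only the `u_I` with `|I| = q` occur. -/
abbrev FormVal (n : ℕ) : Type := EuclideanSpace ℂ (Finset (Fin n))

/-- For `k ∉ K`, `dz̄_k ∧ dz̄_K = wedgeSign k K • dz̄_{K ∪ {k}}`. -/
def wedgeSign {n : ℕ} (k : Fin n) (K : Finset (Fin n)) : ℂ :=
  (-1) ^ (K.filter (fun l => l < k)).card

/-- The coefficient `u_{kK}` of the alternating extension of `(u_I)_I` to all tuples. -/
def coeffCons {n : ℕ} (a : FormVal n) (k : Fin n) (K : Finset (Fin n)) : ℂ :=
  if k ∈ K then 0 else wedgeSign k K * a (insert k K)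

/-- `u` is a `(0,q)`-form with coefficients in `C^∞(Ω̄)`.  Such forms are given as restrictions to
`Ω` of forms that are smooth on `ℂⁿ`; only their values on `Ω` are ever used. -/
structure IsSmoothForm {n : ℕ} (q : ℕ) (u : Cn n → FormVal n) : Prop where
  contDiff : ContDiff ℝ ∞ u
  degree : ∀ z, ∀ I : Finset (Fin n), I.card ≠ q → u z I = 0

/-- The contraction `v_k = ∑_K u_{kK} dz̄_K` of `u`. -/
def contraction {n : ℕ} (k : Fin n) (u : Cn n → FormVal n) : Cn n → FormVal n :=
  fun z => WithLp.toLp 2 (fun K => coeffCons (u z) k K)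

/-- `∂̄u = ∑_I ∑_k ∂u_I/∂z̄_k dz̄_k ∧ dz̄_I` for a smooth form `u`. -/
noncomputable def smoothDbar {n : ℕ} (u : Cn n → FormVal n) : Cn n → FormVal n :=
  fun z => WithLp.toLp 2 (fun J =>
    ∑ k ∈ J, wedgeSign k (J.erase k) * dzbar k (fun w => u w (J.erase k)) z)

/-! The operators `∂̄` and `∂̄*` on square integrable forms. -/

/-- The Hilbert space of forms with coefficients in `L²(Ω)`; it is the orthogonal sum over `q` of
the spaces `L²_{(0,q)}(Ω)`. -/
abbrev L2Forms {n : ℕ} (Ω : Set (Cn n)) : Type := Lp (FormVal n) 2 (volume.restrict Ω)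

/-- Test functions on `Ω`. -/
structure IsTestFunction {n : ℕ} (Ω : Set (Cn n)) (φ : Cn n → ℂ) : Prop where
  contDiff : ContDiff ℝ ∞ φ
  hasCompactSupport : HasCompactSupport φ
  tsupport_subset : tsupport φ ⊆ Ω

/-- `∂̄β = w` in the sense of distributions on `Ω`. -/
def IsWeakDbar {n : ℕ} (Ω : Set (Cn n)) (β w : L2Forms Ω) : Prop :=
  ∀ φ : Cn n → ℂ, IsTestFunction Ω φ → ∀ J : Finset (Fin n),
    ∫ z in Ω, w z J * φ z =
      -∫ z in Ω, ∑ k ∈ J, wedgeSign k (J.erase k) * (β z (J.erase k) * dzbar k φ z)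

theorem integrable_coeff_mul {n : ℕ} {Ω : Set (Cn n)} (f : L2Forms Ω) (I : Finset (Fin n))
    {g : Cn n → ℂ} (hg : Continuous g) (hc : HasCompactSupport g) :
    Integrable (fun z => f z I * g z) (volume.restrict Ω) := by
  have h1 : MemLp (fun z => f z I) 2 (volume.restrict Ω) :=
    (EuclideanSpace.proj I : FormVal n →L[ℂ] ℂ).comp_memLp' (Lp.memLp f)
  have h2 : MemLp g 2 (volume.restrict Ω) := hg.memLp_of_hasCompactSupport hc
  exact h1.integrable_mul h2

theorem IsTestFunction.continuous_dzbar {n : ℕ} {Ω : Set (Cn n)} {φ : Cn n → ℂ}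
    (h : IsTestFunction Ω φ) (k : Fin n) : Continuous (dzbar k φ) := by
  have := h.contDiff.continuous_fderiv (by simp)
  unfold dzbar
  fun_prop

theorem IsTestFunction.hasCompactSupport_dzbar {n : ℕ} {Ω : Set (Cn n)} {φ : Cn n → ℂ}
    (h : IsTestFunction Ω φ) (k : Fin n) : HasCompactSupport (dzbar k φ) := by
  refine (h.hasCompactSupport.fderiv ℝ).comp_left
    (g := fun L : Cn n →L[ℝ] ℂ => (1 / 2 : ℂ) * (L (EuclideanSpace.single k 1)
      + Complex.I * L (EuclideanSpace.single k Complex.I))) (by simp)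

theorem integrable_weakDbar_rhs {n : ℕ} {Ω : Set (Cn n)} (β : L2Forms Ω) {φ : Cn n → ℂ}
    (h : IsTestFunction Ω φ) (J : Finset (Fin n)) :
    Integrable (fun z => ∑ k ∈ J, wedgeSign k (J.erase k) * (β z (J.erase k) * dzbar k φ z))
      (volume.restrict Ω) :=
  integrable_finsetSum _ fun k _ =>
    (integrable_coeff_mul β _ (h.continuous_dzbar k) (h.hasCompactSupport_dzbar k)).const_mul _

/-- The graph of the maximal (weak) extension of `∂̄`. -/
def dbarGraph {n : ℕ} (Ω : Set (Cn n)) : Submodule ℂ (L2Forms Ω × L2Forms Ω) where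
  carrier := {p | IsWeakDbar Ω p.1 p.2}
  zero_mem' := by
    intro φ hφ J
    have h0 : ∀ᵐ z ∂(volume.restrict Ω), (0 : L2Forms Ω) z = 0 := Lp.coeFn_zero _ _ _
    rw [integral_eq_zero_of_ae, integral_eq_zero_of_ae, neg_zero]
    · filter_upwards [h0] with z hz
      refine Finset.sum_eq_zero fun k _ => ?_
      rw [Prod.fst_zero, hz]
      simp
    · filter_upwards [h0] with z hz
      rw [Prod.snd_zero, hz]
      simp
  add_mem' := by
    intro a b ha hb φ hφ J
    have h1 := Lp.coeFn_add a.1 b.1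
    have h2 := Lp.coeFn_add a.2 b.2
    rw [integral_congr_ae (g := fun z => a.2 z J * φ z + b.2 z J * φ z),
      integral_congr_ae (f := fun z => ∑ k ∈ J, wedgeSign k (J.erase k) *
        ((a + b).1 z (J.erase k) * dzbar k φ z))
        (g := fun z => (∑ k ∈ J, wedgeSign k (J.erase k) * (a.1 z (J.erase k) * dzbar k φ z))
          + ∑ k ∈ J, wedgeSign k (J.erase k) * (b.1 z (J.erase k) * dzbar k φ z)),
      integral_add, integral_add, ha φ hφ J, hb φ hφ J]
    · ring
    · exact integrable_weakDbar_rhs _ hφ J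
    · exact integrable_weakDbar_rhs _ hφ J
    · exact integrable_coeff_mul _ _ hφ.contDiff.continuous hφ.hasCompactSupport
    · exact integrable_coeff_mul _ _ hφ.contDiff.continuous hφ.hasCompactSupport
    · filter_upwards [h1] with z hz
      rw [← Finset.sum_add_distrib]
      refine Finset.sum_congr rfl fun k _ => ?_
      rw [Prod.fst_add, hz]
      simp only [Pi.add_apply, PiLp.add_apply]
      ring
    · filter_upwards [h2] with z hz
      rw [Prod.snd_add, hz]
      simp only [Pi.add_apply, PiLp.add_apply]
      ring
  smul_mem' := by
    intro c a ha φ hφ J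
    have h1 := Lp.coeFn_smul c a.1
    have h2 := Lp.coeFn_smul c a.2
    rw [integral_congr_ae (g := fun z => c * (a.2 z J * φ z)),
      integral_congr_ae (f := fun z => ∑ k ∈ J, wedgeSign k (J.erase k) *
        ((c • a).1 z (J.erase k) * dzbar k φ z))
        (g := fun z => c * ∑ k ∈ J, wedgeSign k (J.erase k) * (a.1 z (J.erase k) * dzbar k φ z)),
      integral_const_mul, integral_const_mul, ha φ hφ J]
    · ring
    · filter_upwards [h1] with z hz
      rw [Finset.mul_sum]
      refine Finset.sum_congr rfl fun k _ => ?_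
      rw [Prod.smul_fst, hz]
      simp only [Pi.smul_apply, PiLp.smul_apply, smul_eq_mul]
      ring
    · filter_upwards [h2] with z hz
      rw [Prod.smul_snd, hz]
      simp only [Pi.smul_apply, PiLp.smul_apply, smul_eq_mul]
      ring

/-- On an open set the weak `∂̄` is single-valued, so that `dbarGraph` is the graph of `dbar`. -/
theorem dbarGraph_snd_eq_zero {n : ℕ} {Ω : Set (Cn n)} (hΩ : IsOpen Ω)
    (p : L2Forms Ω × L2Forms Ω) (hp : p ∈ dbarGraph Ω) (h0 : p.1 = 0) : p.2 = 0 := by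
  have hz : ∀ J : Finset (Fin n), ∀ᵐ z ∂volume, z ∈ Ω → p.2 z J = 0 := by
    intro J
    have hL : MemLp (fun z => p.2 z J) 2 (volume.restrict Ω) :=
      (EuclideanSpace.proj J : FormVal n →L[ℂ] ℂ).comp_memLp' (Lp.memLp p.2)
    refine hΩ.ae_eq_zero_of_integral_contDiff_smul_eq_zero ?_ ?_
    · exact (locallyIntegrableOn_of_locallyIntegrable_restrict
        (hL.locallyIntegrable (by norm_num)))
    · intro g hg hc hs
      have ht : IsTestFunction Ω (fun z => (g z : ℂ)) :=
        ⟨Complex.ofRealCLM.contDiff.comp hg, hc.comp_left (g := Complex.ofReal) (by simp),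
          (closure_mono (by intro z hz; simpa using hz)).trans hs⟩
      have h := hp _ ht J
      have h1 : ∀ᵐ z ∂(volume.restrict Ω), p.1 z = 0 := by rw [h0]; exact Lp.coeFn_zero _ _ _
      rw [integral_eq_zero_of_ae (f := fun z => ∑ k ∈ J, wedgeSign k (J.erase k) *
        (p.1 z (J.erase k) * dzbar k (fun z => (g z : ℂ)) z)), neg_zero] at h
      · rw [← setIntegral_eq_integral_of_forall_compl_eq_zero (s := Ω), ← h]
        · refine integral_congr_ae (Filter.Eventually.of_forall fun z => ?_)
          simp [mul_comm]
        · intro z hz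
          rw [image_eq_zero_of_notMem_tsupport (fun h => hz (hs h)), zero_smul]
      · filter_upwards [h1] with z hz
        simp [hz]
  rw [Lp.eq_zero_iff_ae_eq_zero, Filter.EventuallyEq, ae_restrict_iff' hΩ.measurableSet]
  filter_upwards [ae_all_iff.2 hz] with z hz hzΩ
  ext J
  exact hz J hzΩ

/-- The (maximal) operator `∂̄` on square integrable forms on an open set `Ω`. -/
noncomputable def dbar {n : ℕ} (Ω : Set (Cn n)) : L2Forms Ω →ₗ.[ℂ] L2Forms Ω :=
  (dbarGraph Ω).toLinearPMap

/-- The Hilbert space adjoint `∂̄*` of `∂̄`.  It maps `(0,q)`-forms to `(0,q-1)`-forms. -/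
noncomputable def dbarStar {n : ℕ} (Ω : Set (Cn n)) : L2Forms Ω →ₗ.[ℂ] L2Forms Ω :=
  (dbar Ω).adjoint

/-- The `L²`-class on `Ω` of the form `u` is `U`. -/
def Represents {n : ℕ} (Ω : Set (Cn n)) (u : Cn n → FormVal n) (U : L2Forms Ω) : Prop :=
  U =ᵐ[volume.restrict Ω] u

/-! Norms. -/

/-- The square of the norm of `u` in `L²(Ω)`. -/
noncomputable def l2NormSq {n : ℕ} (Ω : Set (Cn n)) (u : Cn n → FormVal n) : ℝ :=
  ∫ z in Ω, ‖u z‖ ^ 2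

/-- The square of the norm of `φ` in the Sobolev space `W¹(Ω)`. -/
noncomputable def w1NormSq {n : ℕ} (Ω : Set (Cn n)) (φ : Cn n → ℂ) : ℝ :=
  ∫ z in Ω, (‖φ z‖ ^ 2 + ∑ j : Fin n, (‖fderiv ℝ φ z (EuclideanSpace.single j 1)‖ ^ 2
    + ‖fderiv ℝ φ z (EuclideanSpace.single j Complex.I)‖ ^ 2))

/-- The norm of `f ∈ L²(Ω)` in `W⁻¹(Ω)`, the dual space of `W¹₀(Ω)`, in which the test functions
are dense. -/
noncomputable def negOneNormFun {n : ℕ} (Ω : Set (Cn n)) (f : Cn n → ℂ) : ℝ :=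
  sSup {t : ℝ | ∃ φ : Cn n → ℂ, IsTestFunction Ω φ ∧ w1NormSq Ω φ ≤ 1 ∧
    t = ‖∫ z in Ω, f z * φ z‖}

/-- The square of the norm of the form `u` in `W⁻¹(Ω)`. -/
noncomputable def negOneNormSq {n : ℕ} (Ω : Set (Cn n)) (u : Cn n → FormVal n) : ℝ :=
  ∑ I : Finset (Fin n), negOneNormFun Ω (fun z => u z I) ^ 2

/-! The two conditions on defining functions. -/

/-- Condition (i): `1/C < |∇ρ_ε| < C` on the boundary of `Ω`. -/
def GradientBounds {n : ℕ} (Ω : Set (Cn n)) (C : ℝ) (ρε : Cn n → ℝ) : Prop :=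
  ∀ z ∈ frontier Ω, 1 / C < ‖gradient ρε z‖ ∧ ‖gradient ρε z‖ < C

/-- The left hand side of condition (ii): the square of the `L²`-norm of
`∑_{|K|=q-1} (∑_{j,k} ∂²ρ_ε/∂z_j∂z̄_k · ∂ρ/∂z̄_j · conj u_{kK}) dz̄_K`. -/
noncomputable def hessianTermSq {n : ℕ} (Ω : Set (Cn n)) (ρ ρε : Cn n → ℝ) (q : ℕ)
    (u : Cn n → FormVal n) : ℝ :=
  ∫ z in Ω, ∑ K : Finset (Fin n) with K.card = q - 1,
    ‖∑ j, ∑ k, complexHessian ρε j k z * dzbar j (toComplex ρ) z *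
      conj (coeffCons (u z) k K)‖ ^ 2

/-- Condition (ii), at the level of `(0,q)`-forms, with constants `ε` and `Cε`. -/
def HessianEstimate {n : ℕ} (Ω : Set (Cn n)) (ρ ρε : Cn n → ℝ) (q : ℕ) (ε Cε : ℝ) : Prop :=
  ∀ (u : Cn n → FormVal n) (U : (dbarStar Ω).domain), IsSmoothForm q u → Represents Ω u U →
    hessianTermSq Ω ρ ρε q u ≤
      ε * (l2NormSq Ω (smoothDbar u) + ‖dbarStar Ω U‖ ^ 2) + Cε * negOneNormSq Ω u

/-- The family `(ρ_ε)_{ε > 0}` of defining functions satisfies (i), with the constant `C`, and (ii)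
at level `q`. -/
def FamilySatisfies {n : ℕ} (Ω : Set (Cn n)) (ρ : Cn n → ℝ) (q : ℕ) (C : ℝ)
    (ρfam : ℝ → Cn n → ℝ) : Prop :=
  ∀ ε : ℝ, 0 < ε → IsDefiningFunction Ω (ρfam ε) ∧ GradientBounds Ω C (ρfam ε) ∧
    ∃ Cε : ℝ, HessianEstimate Ω ρ (ρfam ε) q ε Cε

/-- There is a constant `C` such that for all `ε > 0` there exist a defining function `ρ_ε` and a
constant `C_ε` with (i) and, at level `q`, (ii). -/
def SufficientCondition {n : ℕ} (Ω : Set (Cn n)) (ρ : Cn n → ℝ) (q : ℕ) : Prop :=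
  ∃ C : ℝ, ∀ ε : ℝ, 0 < ε → ∃ (ρε : Cn n → ℝ) (Cε : ℝ), IsDefiningFunction Ω ρε ∧
    GradientBounds Ω C ρε ∧ HessianEstimate Ω ρ ρε q ε Cε

/-! The operators `dz̄_k ∧ ·` and their adjoints. -/

/-! Everything rests on the contractions `v_k` of a form `u` of degree `q + 1`, the contraction
being the pointwise adjoint of `dz̄_k ∧ ·`.

Control of `∂̄*v_k`: since `dz̄_k` has constant coefficients, `∂̄(dz̄_k ∧ β) = -dz̄_k ∧ ∂̄β` holds
weakly (`IsWeakDbar.neg_wedgeOp`). Taking Hilbert space adjoints, contraction anticommutes with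
`∂̄*`. So `v_k` lies in the domain and `‖∂̄*v_k‖ ≤ ‖∂̄*u‖`, without any look at the boundary
(`exists_dbarStar_contractOp`).

Control of `∂̄v_k`: its coefficients are combinations of the derivatives `∂u_J/∂z̄_j`, and on a
pseudoconvex domain the Kohn–Morrey inequality bounds `∑_j ‖∂u/∂z̄_j‖²` by `‖∂̄u‖² + ‖∂̄*u‖²`
(`sum_integral_dzbarForm_le`).

Transfer of the estimate: for `|K| = q ≥ 1` and `m ∈ K`, the `K`-component of the Hessian term of
`u` is, up to sign, the `K \ {m}`-component of the Hessian term of `v_m`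
(`sum_norm_sq_coeffCons_le`). Summing the level `q` estimates for `v_1, …, v_n` gives level `q + 1`.
The loss is a factor `A` that depends on neither `ρ_ε` nor `ε`, which is why the same family works
after rescaling.

Most of the work is Kohn–Morrey, done without surface measure. Boundary integrals are limits of
integrals against `shellDensity r δ`; such a limit is nonnegative when the integrand is nonnegative
on the boundary, because a `C¹` function of that kind is at least `C * r` inside, and the shell
integrals of `r` tend to 0. The tangential boundary condition comes from the weak definition of
`∂̄*`, by testing with forms that do not vanish on the boundary. With it, differentiating along the
boundary turns the boundary integrand into the Levi form. -/

theorem wedgeSign_mul_self {n : ℕ} (k : Fin n) (K : Finset (Fin n)) :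
    wedgeSign k K * wedgeSign k K = 1 := by
  simp [wedgeSign, ← mul_pow]

theorem conj_wedgeSign {n : ℕ} (k : Fin n) (K : Finset (Fin n)) :
    conj (wedgeSign k K) = wedgeSign k K := by
  simp [wedgeSign]

theorem norm_wedgeSign {n : ℕ} (k : Fin n) (K : Finset (Fin n)) : ‖wedgeSign k K‖ = 1 := by
  simp [wedgeSign]

theorem wedgeSign_insert {n : ℕ} {k l : Fin n} {K : Finset (Fin n)} (hl : l ∉ K) :
    wedgeSign k (insert l K) = (if l < k then -1 else 1) * wedgeSign k K := by
  unfold wedgeSign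
  rw [Finset.filter_insert]
  split_ifs with h
  · rw [Finset.card_insert_of_notMem (by simp [hl]), pow_succ]
    ring
  · simp

/-- Exactly one of `l < k` and `k < l` holds, so exactly one side picks up an extra sign. All
anticommutation rules below reduce to this. -/
theorem wedgeSign_insert_mul {n : ℕ} {k l : Fin n} (hkl : k ≠ l) {K : Finset (Fin n)}
    (hk : k ∉ K) (hl : l ∉ K) :
    wedgeSign k (insert l K) * wedgeSign l K = -(wedgeSign l (insert k K) * wedgeSign k K) := by
  rw [wedgeSign_insert hl, wedgeSign_insert hk]
  rcases lt_or_gt_of_ne hkl with h | h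
  · simp [h, h.not_gt]
    ring
  · simp [h, h.not_gt]
    ring

/-- The map `a ↦ dz̄_k ∧ a`. -/
noncomputable def wedgeOp {n : ℕ} (k : Fin n) : FormVal n →L[ℂ] FormVal n :=
  LinearMap.toContinuousLinearMap
    { toFun := fun a => WithLp.toLp 2 (fun J =>
        if k ∈ J then wedgeSign k (J.erase k) * a (J.erase k) else 0)
      map_add' := by
        intro a b
        ext J
        by_cases h : k ∈ J <;> simp [h, mul_add]
      map_smul' := by
        intro c a
        ext J
        by_cases h : k ∈ J <;> simp [h, mul_left_comm] }

/-- The map `a ↦ ∑_K a_{kK} dz̄_K`. -/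
noncomputable def contractOp {n : ℕ} (k : Fin n) : FormVal n →L[ℂ] FormVal n :=
  LinearMap.toContinuousLinearMap
    { toFun := fun a => WithLp.toLp 2 (fun K => coeffCons a k K)
      map_add' := by
        intro a b
        ext J
        by_cases h : k ∈ J <;> simp [coeffCons, h, mul_add]
      map_smul' := by
        intro c a
        ext J
        by_cases h : k ∈ J <;> simp [coeffCons, h, mul_left_comm] }

theorem wedgeOp_apply {n : ℕ} (k : Fin n) (a : FormVal n) (J : Finset (Fin n)) :
    wedgeOp k a J = if k ∈ J then wedgeSign k (J.erase k) * a (J.erase k) else 0 := rfl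

theorem contractOp_apply {n : ℕ} (k : Fin n) (a : FormVal n) (K : Finset (Fin n)) :
    contractOp k a K = if k ∈ K then 0 else wedgeSign k K * a (insert k K) := rfl

/-- Removing `k` is a bijection from the sets containing `k` onto those that do not. Adjointness,
the `W⁻¹` bound and the Hessian term are all reindexed this way. -/
theorem sum_wedge_eq_sum_contract {n : ℕ} {M : Type*} [AddCommMonoid M] (k : Fin n)
    (f : Finset (Fin n) → Finset (Fin n) → M) :
    (∑ J : Finset (Fin n), if k ∈ J then f (J.erase k) J else 0) =
      ∑ K : Finset (Fin n), if k ∈ K then 0 else f K (insert k K) := by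
  have h : ∀ K : Finset (Fin n), (if k ∈ K then 0 else f K (insert k K)) =
      if k ∉ K then f K (insert k K) else 0 := fun K => by split_ifs <;> rfl
  simp_rw [h]
  rw [← Finset.sum_filter, ← Finset.sum_filter]
  refine Finset.sum_bij' (fun J _ => J.erase k) (fun K _ => insert k K) ?_ ?_ ?_ ?_ ?_
  · intro J hJ
    simp
  · intro K hK
    simp
  · intro J hJ
    exact Finset.insert_erase (by simpa using hJ)
  · intro K hK
    exact Finset.erase_insert (by simpa using hK)
  · intro J hJ
    rw [Finset.insert_erase (by simpa using hJ)]

theorem inner_contractOp_left {n : ℕ} (k : Fin n) (a b : FormVal n) :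
    ⟪contractOp k a, b⟫_ℂ = ⟪a, wedgeOp k b⟫_ℂ := by
  rw [PiLp.inner_apply, PiLp.inner_apply]
  have h := sum_wedge_eq_sum_contract k
    (fun K J => wedgeSign k K * b K * conj (a J))
  simp only [RCLike.inner_apply, wedgeOp_apply, contractOp_apply]
  calc _ = ∑ K : Finset (Fin n), if k ∈ K then 0 else
        wedgeSign k K * b K * conj (a (insert k K)) := by
        refine Finset.sum_congr rfl fun K _ => ?_
        split_ifs
        · simp
        · rw [map_mul, conj_wedgeSign]
          ring
    _ = _ := by
        rw [← h]
        refine Finset.sum_congr rfl fun K _ => ?_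
        split_ifs <;> simp

theorem inner_wedgeOp_left {n : ℕ} (k : Fin n) (a b : FormVal n) :
    ⟪wedgeOp k a, b⟫_ℂ = ⟪a, contractOp k b⟫_ℂ := by
  rw [← inner_conj_symm, ← inner_contractOp_left, inner_conj_symm]

theorem wedgeOp_wedgeOp {n : ℕ} (j k : Fin n) (a : FormVal n) :
    wedgeOp j (wedgeOp k a) = -wedgeOp k (wedgeOp j a) := by
  ext J
  simp only [wedgeOp_apply, PiLp.neg_apply, Finset.mem_erase]
  by_cases hjk : j = k
  · subst hjk
    simp
  by_cases hj : j ∈ J <;> by_cases hk : k ∈ J <;> simp [hj, hk, hjk, Ne.symm hjk]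
  -- Only `j, k ∈ J` is not trivial; both sides are then multiples of the coefficient at `L = J \
  -- {j, k}`.
  obtain ⟨L, hL, hjL, hkL⟩ : ∃ L, (J.erase j).erase k = L ∧ j ∉ L ∧ k ∉ L := ⟨_, rfl, by simp, by simp⟩
  have h1 : J.erase j = insert k L := by
    rw [← hL, Finset.insert_erase (by simp [hk, Ne.symm hjk])]
  have h2 : (J.erase k).erase j = L := by rw [← hL, Finset.erase_right_comm]
  have h3 : J.erase k = insert j L := by
    rw [← h2, Finset.insert_erase (by simp [hj, hjk])]
  rw [h2, hL, h1, h3]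
  linear_combination a L * wedgeSign_insert_mul hjk hjL hkL

theorem contractOp_contractOp {n : ℕ} (j k : Fin n) (a : FormVal n) :
    contractOp j (contractOp k a) = -contractOp k (contractOp j a) := by
  refine ext_inner_right ℂ fun b => ?_
  rw [inner_neg_left, inner_contractOp_left, inner_contractOp_left, inner_contractOp_left,
    inner_contractOp_left, wedgeOp_wedgeOp k j, inner_neg_right]

/-- The canonical anticommutation relation; its diagonal part gives the norm bounds, its
off-diagonal part the mixed terms in Kohn–Morrey. -/
theorem contractOp_wedgeOp {n : ℕ} (j k : Fin n) (a : FormVal n) :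
    contractOp j (wedgeOp k a) = (if j = k then a else 0) - wedgeOp k (contractOp j a) := by
  ext K
  by_cases hjk : j = k
  · subst hjk
    by_cases hj : j ∈ K
    · simp [wedgeOp_apply, contractOp_apply, hj, ← mul_assoc, wedgeSign_mul_self]
    · simp [wedgeOp_apply, contractOp_apply, hj, ← mul_assoc, wedgeSign_mul_self]
  · by_cases hj : j ∈ K <;> by_cases hk : k ∈ K <;>
      simp [wedgeOp_apply, contractOp_apply, hj, hk, hjk, Ne.symm hjk]
    obtain ⟨L, hL, hjL, hkL⟩ : ∃ L, K.erase k = L ∧ j ∉ L ∧ k ∉ L :=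
      ⟨_, rfl, by simp [hj], by simp⟩
    have h1 : K = insert k L := by rw [← hL, Finset.insert_erase hk]
    have h2 : (insert j K).erase k = insert j L := by
      rw [Finset.erase_insert_of_ne hjk, hL]
    rw [h2, hL, h1]
    have h3 := wedgeSign_insert_mul hjk hjL hkL
    have h4 := wedgeSign_mul_self k (insert j L)
    have h5 := wedgeSign_mul_self k L
    -- `h3` exchanges the two insertions; `h4` and `h5` remove squares of signs.
    linear_combination a (insert j L) * (wedgeSign k (insert j L) * wedgeSign k L * h3
      - wedgeSign j (insert k L) * wedgeSign k (insert j L) * h5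
      - wedgeSign j L * wedgeSign k L * h4)

/-- The anticommutation relation with `j = k` gives the Pythagorean identity `‖contractOp k a‖² +
‖wedgeOp k a‖² = ‖a‖²`. -/
theorem norm_contractOp_le {n : ℕ} (k : Fin n) (a : FormVal n) : ‖contractOp k a‖ ≤ ‖a‖ := by
  have h : ⟪contractOp k a, contractOp k a⟫_ℂ + ⟪wedgeOp k a, wedgeOp k a⟫_ℂ = ⟪a, a⟫_ℂ := by
    rw [inner_contractOp_left, inner_wedgeOp_left, contractOp_wedgeOp, if_pos rfl,
      inner_sub_right]
    ring
  rw [inner_self_eq_norm_sq_to_K, inner_self_eq_norm_sq_to_K, inner_self_eq_norm_sq_to_K] at h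
  have h' : ‖contractOp k a‖ ^ 2 + ‖wedgeOp k a‖ ^ 2 = ‖a‖ ^ 2 := by exact_mod_cast h
  exact le_of_sq_le_sq (by nlinarith [sq_nonneg ‖wedgeOp k a‖]) (norm_nonneg _)

theorem norm_wedgeOp_le {n : ℕ} (k : Fin n) (a : FormVal n) : ‖wedgeOp k a‖ ≤ ‖a‖ := by
  have h : ⟪contractOp k a, contractOp k a⟫_ℂ + ⟪wedgeOp k a, wedgeOp k a⟫_ℂ = ⟪a, a⟫_ℂ := by
    rw [inner_contractOp_left, inner_wedgeOp_left, contractOp_wedgeOp, if_pos rfl,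
      inner_sub_right]
    ring
  rw [inner_self_eq_norm_sq_to_K, inner_self_eq_norm_sq_to_K, inner_self_eq_norm_sq_to_K] at h
  have h' : ‖contractOp k a‖ ^ 2 + ‖wedgeOp k a‖ ^ 2 = ‖a‖ ^ 2 := by exact_mod_cast h
  exact le_of_sq_le_sq (by nlinarith [sq_nonneg ‖contractOp k a‖]) (norm_nonneg _)

/-- The algebraic half of Kohn–Morrey: for `d k = ∂u/∂z̄_k` the left side is `|∂̄u|²`, and the
double sum is what integration by parts converts into `|∂̄*u|²` and a boundary term. -/
theorem norm_sum_wedgeOp_sq {n : ℕ} (d : Fin n → FormVal n) :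
    (‖∑ k, wedgeOp k (d k)‖ ^ 2 : ℝ) =
      ∑ j, ‖d j‖ ^ 2 - (∑ j, ∑ k, ⟪contractOp k (d j), contractOp j (d k)⟫_ℂ).re := by
  have h : ⟪∑ k, wedgeOp k (d k), ∑ k, wedgeOp k (d k)⟫_ℂ =
      ∑ j, ⟪d j, d j⟫_ℂ - ∑ j, ∑ k, ⟪contractOp k (d j), contractOp j (d k)⟫_ℂ := by
    rw [sum_inner, ← Finset.sum_sub_distrib]
    refine Finset.sum_congr rfl fun j _ => ?_
    rw [inner_sum]
    simp_rw [inner_wedgeOp_left, contractOp_wedgeOp, inner_sub_right, Finset.sum_sub_distrib]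
    congr 1
    · rw [Finset.sum_eq_single j] <;> simp +contextual [eq_comm]
    · simp_rw [inner_contractOp_left]
  have hn : ∀ x : FormVal n, (⟪x, x⟫_ℂ).re = ‖x‖ ^ 2 := fun x => inner_self_eq_norm_sq (𝕜 := ℂ) x
  have h2 := congrArg Complex.re h
  rw [Complex.sub_re, Complex.re_sum, hn] at h2
  simpa only [hn] using h2

/-! Wirtinger calculus. -/

section Wirtinger

variable {n : ℕ} {f g : Cn n → ℂ} {z : Cn n}

theorem dz_mul (j : Fin n) (hf : DifferentiableAt ℝ f z) (hg : DifferentiableAt ℝ g z) :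
    dz j (fun w => f w * g w) z = dz j f z * g z + f z * dz j g z := by
  simp only [dz, fderiv_fun_mul hf hg, add_apply, smul_apply, smul_eq_mul]
  ring

theorem dzbar_mul (j : Fin n) (hf : DifferentiableAt ℝ f z) (hg : DifferentiableAt ℝ g z) :
    dzbar j (fun w => f w * g w) z = dzbar j f z * g z + f z * dzbar j g z := by
  simp only [dzbar, fderiv_fun_mul hf hg, add_apply, smul_apply, smul_eq_mul]
  ring

theorem dz_sum {ι : Type*} (s : Finset ι) {F : ι → Cn n → ℂ} (j : Fin n)
    (hF : ∀ i ∈ s, DifferentiableAt ℝ (F i) z) :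
    dz j (fun w => ∑ i ∈ s, F i w) z = ∑ i ∈ s, dz j (F i) z := by
  simp only [dz, fderiv_fun_sum hF, sum_apply, Finset.mul_sum,
    ← Finset.sum_sub_distrib]

theorem dzbar_const_mul (j : Fin n) (c : ℂ) (hf : DifferentiableAt ℝ f z) :
    dzbar j (fun w => c * f w) z = c * dzbar j f z := by
  simp only [dzbar, fderiv_const_mul hf, smul_apply, smul_eq_mul]
  ring

theorem fderiv_conj (hf : DifferentiableAt ℝ f z) (v : Cn n) :
    fderiv ℝ (fun w => conj (f w)) z v = conj (fderiv ℝ f z v) := by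
  have h := (Complex.conjCLE.toContinuousLinearMap.hasFDerivAt (x := f z)).comp z hf.hasFDerivAt
  exact congrArg (fun L : Cn n →L[ℝ] ℂ => L v) h.fderiv

theorem dz_conj (j : Fin n) (hf : DifferentiableAt ℝ f z) :
    dz j (fun w => conj (f w)) z = conj (dzbar j f z) := by
  have h2 : conj (2 : ℂ) = 2 := Complex.conj_ofNat 2
  simp only [dz, dzbar, fderiv_conj hf, map_mul, map_div₀, map_one, h2, map_add, Complex.conj_I]
  ring

theorem dzbar_conj (j : Fin n) (hf : DifferentiableAt ℝ f z) :
    dzbar j (fun w => conj (f w)) z = conj (dz j f z) := by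
  have h2 : conj (2 : ℂ) = 2 := Complex.conj_ofNat 2
  simp only [dz, dzbar, fderiv_conj hf, map_mul, map_div₀, map_one, h2, map_sub, Complex.conj_I]
  ring

theorem ContDiff.dz {m : WithTop ℕ∞} (hf : ContDiff ℝ (m + 1) f) (j : Fin n) :
    ContDiff ℝ m (dz j f) := by
  have h := hf.fderiv_right (m := m) le_rfl
  unfold _root_.dz
  fun_prop

theorem ContDiff.dzbar {m : WithTop ℕ∞} (hf : ContDiff ℝ (m + 1) f) (j : Fin n) :
    ContDiff ℝ m (dzbar j f) := by
  have h := hf.fderiv_right (m := m) le_rfl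
  unfold _root_.dzbar
  fun_prop

theorem fderiv_fderiv_apply (hf : ContDiff ℝ 2 f) (v w : Cn n) :
    fderiv ℝ (fun x => fderiv ℝ f x v) z w = fderiv ℝ (fderiv ℝ f) z w v := by
  have h : DifferentiableAt ℝ (fderiv ℝ f) z :=
    ((hf.fderiv_right (m := 1) (by norm_num)).differentiable one_ne_zero) z
  rw [fderiv_clm_apply h (differentiableAt_const v)]
  simp

theorem dz_dzbar_comm (hf : ContDiff ℝ 2 f) (j k : Fin n) :
    dz j (dzbar k f) z = dzbar k (dz j f) z := by
  have hs : IsSymmSndFDerivAt ℝ f z := hf.contDiffAt.isSymmSndFDerivAt (by simp)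
  have h1 : ContDiff ℝ 1 (fderiv ℝ f) := hf.fderiv_right (m := 1) (by norm_num)
  have hd : ∀ v : Cn n, DifferentiableAt ℝ (fun x => fderiv ℝ f x v) z := fun v =>
    ((h1.clm_apply contDiff_const).differentiable one_ne_zero) z
  have hb : ∀ w, fderiv ℝ (dzbar k f) z w = (1 / 2 : ℂ) *
      (fderiv ℝ (fderiv ℝ f) z w (EuclideanSpace.single k 1)
      + Complex.I * fderiv ℝ (fderiv ℝ f) z w (EuclideanSpace.single k Complex.I)) := by
    intro w
    unfold dzbar
    rw [fderiv_const_mul ((hd _).fun_add ((hd _).const_mul _)), fderiv_fun_add (hd _) ((hd _).const_mul _),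
      fderiv_const_mul (hd _)]
    simp only [add_apply, smul_apply, smul_eq_mul, fderiv_fderiv_apply hf]
  have ha : ∀ w, fderiv ℝ (dz j f) z w = (1 / 2 : ℂ) *
      (fderiv ℝ (fderiv ℝ f) z w (EuclideanSpace.single j 1)
      - Complex.I * fderiv ℝ (fderiv ℝ f) z w (EuclideanSpace.single j Complex.I)) := by
    intro w
    unfold dz
    rw [fderiv_const_mul ((hd _).fun_sub ((hd _).const_mul _)), fderiv_fun_sub (hd _) ((hd _).const_mul _),
      fderiv_const_mul (hd _)]
    simp only [sub_apply, smul_apply, smul_eq_mul, fderiv_fderiv_apply hf]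
  rw [dz, dzbar, hb, hb, ha, ha, hs.eq (EuclideanSpace.single k 1), hs.eq (EuclideanSpace.single k 1),
    hs.eq (EuclideanSpace.single k Complex.I), hs.eq (EuclideanSpace.single k Complex.I)]
  ring

theorem integral_fderiv_apply_eq_zero (hg : ContDiff ℝ 1 g) (hc : HasCompactSupport g) (v : Cn n) :
    ∫ x, fderiv ℝ g x v = 0 := by
  have hd := hg.differentiable one_ne_zero
  have h := integral_mul_fderiv_eq_neg_fderiv_mul_of_integrable (μ := (volume : Measure (Cn n)))
    (f := fun _ => (1 : ℂ)) (g := g) (v := v) (by simp) ?_ ?_ (by simp) (fun x _ => hd x)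
  · simpa using h
  · simp only [one_mul]
    exact ((hg.continuous_fderiv one_ne_zero).clm_apply continuous_const).integrable_of_hasCompactSupport
      (hc.fderiv_apply ℝ v)
  · simpa using hg.continuous.integrable_of_hasCompactSupport hc

theorem integrable_fderiv_apply (hg : ContDiff ℝ 1 g) (hc : HasCompactSupport g) (v : Cn n) :
    Integrable (fun x => fderiv ℝ g x v) :=
  ((hg.continuous_fderiv one_ne_zero).clm_apply continuous_const).integrable_of_hasCompactSupport
    (hc.fderiv_apply ℝ v)

theorem integral_dzbar_eq_zero (hg : ContDiff ℝ 1 g) (hc : HasCompactSupport g) (k : Fin n) :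
    ∫ x, dzbar k g x = 0 := by
  unfold dzbar
  rw [integral_const_mul, integral_add, integral_const_mul, integral_fderiv_apply_eq_zero hg hc,
    integral_fderiv_apply_eq_zero hg hc]
  · simp
  · exact integrable_fderiv_apply hg hc _
  · exact (integrable_fderiv_apply hg hc _).const_mul _

theorem dzbar_eq_zero_of_notMem_tsupport (k : Fin n) (hz : z ∉ tsupport g) : dzbar k g z = 0 := by
  have h : fderiv ℝ g z = 0 := by
    by_contra h
    exact hz (support_fderiv_subset ℝ h)
  simp [dzbar, h]

end Wirtinger

theorem smoothDbar_eq_sum {n : ℕ} (u : Cn n → FormVal n) (z : Cn n) :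
    smoothDbar u z =
      ∑ k, wedgeOp k (WithLp.toLp 2 fun I => dzbar k (fun w => u w I) z) := by
  ext J
  simp only [smoothDbar, PiLp.toLp_apply]
  rw [WithLp.ofLp_sum, Finset.sum_apply]
  simp only [wedgeOp_apply, ← Finset.sum_filter]
  simp

/-! The operators `∂̄` and `∂̄*` on square integrable forms. -/

section Operators

variable {n : ℕ} {Ω : Set (Cn n)}

theorem isWeakDbar_dbar (hΩ : IsOpen Ω) (β : (dbar Ω).domain) : IsWeakDbar Ω β (dbar Ω β) :=
  Submodule.mem_graph_toLinearPMap (g := dbarGraph Ω) (dbarGraph_snd_eq_zero hΩ) β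

theorem IsWeakDbar.mem_domain {β w : L2Forms Ω} (h : IsWeakDbar Ω β w) : β ∈ (dbar Ω).domain :=
  ⟨(β, w), h, rfl⟩

theorem IsWeakDbar.dbar_eq (hΩ : IsOpen Ω) {β w : L2Forms Ω} (h : IsWeakDbar Ω β w) :
    dbar Ω ⟨β, h.mem_domain⟩ = w := by
  have h1 : (β, w) ∈ (dbar Ω).graph := by
    rw [dbar, Submodule.toLinearPMap_graph_eq _ (dbarGraph_snd_eq_zero hΩ)]
    exact h
  obtain ⟨y, hy1, hy2⟩ := (LinearPMap.mem_graph_iff _).1 h1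
  exact (congrArg (dbar Ω) (Subtype.ext hy1.symm)).trans hy2

theorem integrable_test {f φ : Cn n → ℂ} (hf : ContDiff ℝ 1 f) (hφ : IsTestFunction Ω φ)
    (k : Fin n) : Integrable (fun z => dzbar k f z * φ z) (volume.restrict Ω) ∧
    Integrable (fun z => f z * dzbar k φ z) (volume.restrict Ω) := by
  constructor
  · refine (Continuous.integrable_of_hasCompactSupport ?_ hφ.hasCompactSupport.mul_left).restrict
    exact (ContDiff.dzbar (m := 0) (by simpa using hf) k).continuous.mul hφ.contDiff.continuous
  · refine (Continuous.integrable_of_hasCompactSupport ?_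
      (hφ.hasCompactSupport_dzbar k).mul_left).restrict
    exact hf.continuous.mul (hφ.continuous_dzbar k)

/-- The product `f φ` has compact support inside `Ω`, so the integral extends to all of `ℂⁿ` and no
boundary term appears. -/
theorem setIntegral_dzbar_mul {f φ : Cn n → ℂ} (hf : ContDiff ℝ 1 f) (hφ : IsTestFunction Ω φ)
    (k : Fin n) :
    ∫ z in Ω, dzbar k f z * φ z = -∫ z in Ω, f z * dzbar k φ z := by
  obtain ⟨h1, h2⟩ := integrable_test hf hφ k
  have hφ1 : ContDiff ℝ 1 φ := hφ.contDiff.of_le (by simp)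
  have h3 : ∀ z, dzbar k f z * φ z + f z * dzbar k φ z = dzbar k (fun w => f w * φ w) z := fun z =>
    (dzbar_mul k (hf.differentiable one_ne_zero z) (hφ1.differentiable one_ne_zero z)).symm
  rw [eq_neg_iff_add_eq_zero, ← integral_add h1 h2]
  simp_rw [h3]
  rw [setIntegral_eq_integral_of_forall_compl_eq_zero]
  · exact integral_dzbar_eq_zero (hf.mul hφ1) hφ.hasCompactSupport.mul_left k
  · intro z hz
    refine dzbar_eq_zero_of_notMem_tsupport k fun h => hz (hφ.tsupport_subset ?_)
    exact tsupport_mul_subset_right h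

/-- On forms of class `C¹` the weak operator `∂̄` is the classical one. -/
theorem isWeakDbar_of_contDiff {β : Cn n → FormVal n} (hβ : ContDiff ℝ 1 β) {B W : L2Forms Ω}
    (hB : Represents Ω β B) (hW : Represents Ω (smoothDbar β) W) : IsWeakDbar Ω B W := by
  intro φ hφ J
  have hβI : ∀ I, ContDiff ℝ 1 (fun z => β z I) := fun I => by fun_prop
  calc ∫ z in Ω, W z J * φ z = ∫ z in Ω, ∑ k ∈ J, wedgeSign k (J.erase k) *
        (dzbar k (fun w => β w (J.erase k)) z * φ z) := by
        refine integral_congr_ae ?_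
        filter_upwards [hW] with z hz
        rw [hz]
        simp [smoothDbar, Finset.sum_mul, mul_assoc]
    _ = ∑ k ∈ J, wedgeSign k (J.erase k) *
        ∫ z in Ω, dzbar k (fun w => β w (J.erase k)) z * φ z := by
        rw [integral_finsetSum _ fun k _ => ((integrable_test (hβI _) hφ k).1.const_mul _)]
        simp_rw [integral_const_mul]
    _ = -∫ z in Ω, ∑ k ∈ J, wedgeSign k (J.erase k) * (β z (J.erase k) * dzbar k φ z) := by
        rw [integral_finsetSum _ fun k _ => ((integrable_test (hβI _) hφ k).2.const_mul _)]
        simp_rw [integral_const_mul, setIntegral_dzbar_mul (hβI _) hφ]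
        simp
    _ = _ := by
        congr 1
        refine integral_congr_ae ?_
        filter_upwards [hB] with z hz
        rw [hz]

/-- For `m ∈ J` the test identity at `J` is, up to sign, that of `β` at `J \ {m}`; for `m ∉ J` both
sides vanish. -/
theorem IsWeakDbar.neg_wedgeOp {β w : L2Forms Ω} (h : IsWeakDbar Ω β w) (m : Fin n) :
    IsWeakDbar Ω ((wedgeOp m).compLp β) (-(wedgeOp m).compLp w) := by
  intro φ hφ J
  have h1 := ContinuousLinearMap.coeFn_compLp (wedgeOp m) β
  have h2 := ContinuousLinearMap.coeFn_compLp (wedgeOp m) w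
  have h3 := Lp.coeFn_neg ((wedgeOp m).compLp w)
  -- Recognizes the integrand of the weak equation as a coefficient of `∑ c_k dz̄_k ∧ a`, so that
  -- anticommutation of wedges applies.
  have key : ∀ (J : Finset (Fin n)) (a : FormVal n) (c : Fin n → ℂ),
      ∑ k ∈ J, wedgeSign k (J.erase k) * (a (J.erase k) * c k) =
        (∑ k, c k • wedgeOp k a) J := by
    intro J a c
    rw [WithLp.ofLp_sum, Finset.sum_apply]
    simp only [PiLp.smul_apply, smul_eq_mul, wedgeOp_apply]
    simp [mul_comm, mul_left_comm]
  have e1 : ∫ z in Ω, (-(wedgeOp m).compLp w : L2Forms Ω) z J * φ z =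
      ∫ z in Ω, -((wedgeOp m (w z)) J * φ z) := by
    refine integral_congr_ae ?_
    filter_upwards [h2, h3] with z hz hz3
    rw [hz3, Pi.neg_apply, hz]
    simp
  have e2 : ∫ z in Ω, ∑ k ∈ J, wedgeSign k (J.erase k) *
        ((wedgeOp m).compLp β z (J.erase k) * dzbar k φ z) =
      ∫ z in Ω, -(wedgeOp m (∑ k, dzbar k φ z • wedgeOp k (β z))) J := by
    refine integral_congr_ae ?_
    filter_upwards [h1] with z hz
    rw [key, hz, ← PiLp.neg_apply, map_sum, ← Finset.sum_neg_distrib]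
    simp_rw [map_smul, wedgeOp_wedgeOp m, smul_neg, neg_neg]
  rw [e1, e2, integral_neg, integral_neg, neg_neg, neg_eq_iff_eq_neg]
  by_cases hm : m ∈ J
  · simp only [wedgeOp_apply m, hm, if_true, mul_assoc, ← key]
    rw [integral_const_mul, integral_const_mul, h φ hφ]
    ring
  · simp [wedgeOp_apply m, hm]

end Operators

/-! ### The adjoint `∂̄*`: contractions, interior formula, weak boundary condition -/

section AdjointDomain

variable {n : ℕ} {Ω : Set (Cn n)}

theorem IsTestFunction.mono {Ω' : Set (Cn n)} {φ : Cn n → ℂ} (h : IsTestFunction Ω φ)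
    (hΩ : Ω ⊆ Ω') : IsTestFunction Ω' φ :=
  ⟨h.contDiff, h.hasCompactSupport, h.tsupport_subset.trans hΩ⟩

theorem IsTestFunction.conj {φ : Cn n → ℂ} (h : IsTestFunction Ω φ) :
    IsTestFunction Ω (fun z => conj (φ z)) :=
  ⟨Complex.conjCLE.contDiff.comp h.contDiff,
    h.hasCompactSupport.comp_left (g := fun w => (starRingEnd ℂ) w) (by simp),
    (closure_mono (by intro z hz; simpa using hz)).trans h.tsupport_subset⟩

theorem isTestFunction_ofReal {g : Cn n → ℝ} (hg : ContDiff ℝ ∞ g) (hc : HasCompactSupport g)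
    (hs : tsupport g ⊆ Ω) : IsTestFunction Ω (fun z => (g z : ℂ)) :=
  ⟨Complex.ofRealCLM.contDiff.comp hg, hc.comp_left (g := Complex.ofReal) (by simp),
    (closure_mono (by intro z hz; simpa using hz)).trans hs⟩

theorem dz_eq_conj_dzbar {f : Cn n → ℂ} {z : Cn n} (k : Fin n) (hf : DifferentiableAt ℝ f z) :
    dz k f z = conj (dzbar k (fun w => conj (f w)) z) := by
  rw [dzbar_conj k hf, Complex.conj_conj]

theorem setIntegral_dz_mul {f φ : Cn n → ℂ} (hf : ContDiff ℝ 1 f) (hφ : IsTestFunction Ω φ)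
    (k : Fin n) :
    ∫ z in Ω, dz k f z * φ z = -∫ z in Ω, f z * dz k φ z := by
  have h := setIntegral_dzbar_mul (Complex.conjCLE.contDiff.comp hf) hφ.conj k
  have h2 := congrArg (starRingEnd ℂ) h
  rw [map_neg, ← integral_conj, ← integral_conj] at h2
  have hφ1 : ContDiff ℝ 1 φ := hφ.contDiff.of_le (by simp)
  refine Eq.trans ?_ (h2.trans (congrArg Neg.neg ?_))
  · refine integral_congr_ae (Filter.Eventually.of_forall fun z => ?_)
    beta_reduce
    rw [map_mul, Complex.conj_conj, dz_eq_conj_dzbar k (hf.differentiable one_ne_zero z)]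
    rfl
  · refine integral_congr_ae (Filter.Eventually.of_forall fun z => ?_)
    beta_reduce
    rw [map_mul, dz_eq_conj_dzbar k (hφ1.differentiable one_ne_zero z)]
    simp

theorem dzbar_smul_const {φ : Cn n → ℂ} {z : Cn n} (k : Fin n) (hφ : DifferentiableAt ℝ φ z)
    (a : FormVal n) :
    (WithLp.toLp 2 fun I => dzbar k (fun w => (φ w • a) I) z : FormVal n) = dzbar k φ z • a := by
  ext I
  have h : (fun w => (φ w • a) I) = fun w => a I * φ w := by
    ext w
    simp [mul_comm]
  rw [PiLp.toLp_apply, h, dzbar_const_mul k _ hφ]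
  simp [mul_comm]

theorem smoothDbar_smul_const {φ : Cn n → ℂ} {z : Cn n} (hφ : DifferentiableAt ℝ φ z)
    (a : FormVal n) :
    smoothDbar (fun w => φ w • a) z = ∑ k, dzbar k φ z • wedgeOp k a := by
  rw [smoothDbar_eq_sum]
  simp_rw [dzbar_smul_const _ hφ, map_smul]

/-- Here `φ` has compact support in `ℂⁿ`, not in `Ω`. Since the maximal `∂̄` imposes no boundary
condition, these forms may be paired with `∂̄*`, and they see the boundary. -/
theorem exists_isWeakDbar_smul_const (Ω : Set (Cn n)) {φ : Cn n → ℂ}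
    (hφ : IsTestFunction Set.univ φ) (a : FormVal n) :
    ∃ B W : L2Forms Ω, IsWeakDbar Ω B W ∧ Represents Ω (fun z => φ z • a) B ∧
      Represents Ω (fun z => ∑ k, dzbar k φ z • wedgeOp k a) W := by
  have hB : MemLp (fun z => φ z • a) 2 (volume.restrict Ω) :=
    Continuous.memLp_of_hasCompactSupport (hφ.contDiff.continuous.smul continuous_const)
      hφ.hasCompactSupport.smul_right
  have hW : MemLp (fun z => ∑ k, dzbar k φ z • wedgeOp k a) 2 (volume.restrict Ω) :=
    memLp_finsetSum _ fun k _ => Continuous.memLp_of_hasCompactSupport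
      ((hφ.continuous_dzbar k).smul continuous_const) (hφ.hasCompactSupport_dzbar k).smul_right
  have hφ1 : ContDiff ℝ 1 φ := hφ.contDiff.of_le (by simp)
  refine ⟨hB.toLp, hW.toLp, ?_, hB.coeFn_toLp, hW.coeFn_toLp⟩
  refine isWeakDbar_of_contDiff (hφ1.smul contDiff_const) hB.coeFn_toLp ?_
  filter_upwards [hW.coeFn_toLp] with z hz
  rw [hz]
  exact (smoothDbar_smul_const (hφ1.differentiable one_ne_zero z) a).symm

theorem ae_eq_zero_of_setIntegral_mul_eq_zero (hΩ : IsOpen Ω) {f : Cn n → ℂ}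
    (hf : LocallyIntegrable f (volume.restrict Ω))
    (h : ∀ φ : Cn n → ℂ, IsTestFunction Ω φ → ∫ z in Ω, f z * φ z = 0) :
    ∀ᵐ z ∂(volume.restrict Ω), f z = 0 := by
  rw [ae_restrict_iff' hΩ.measurableSet]
  refine hΩ.ae_eq_zero_of_integral_contDiff_smul_eq_zero
    (locallyIntegrableOn_of_locallyIntegrable_restrict hf) fun g hg hc hs => ?_
  rw [← h _ (isTestFunction_ofReal hg hc hs),
    ← setIntegral_eq_integral_of_forall_compl_eq_zero (s := Ω)]
  · refine integral_congr_ae (Filter.Eventually.of_forall fun z => ?_)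
    simp [mul_comm]
  · intro z hz
    rw [image_eq_zero_of_notMem_tsupport (fun h => hz (hs h)), zero_smul]

theorem L2Forms.locallyIntegrable_coeff (f : L2Forms Ω) (I : Finset (Fin n)) :
    LocallyIntegrable (fun z => f z I) (volume.restrict Ω) := by
  have h1 : MemLp (fun z => f z I) 2 (volume.restrict Ω) :=
    (EuclideanSpace.proj I : FormVal n →L[ℂ] ℂ).comp_memLp' (Lp.memLp f)
  exact h1.locallyIntegrable (by norm_num)

/-- The forms `φ dz̄_J` with `φ` a test function on `Ω` already have trivial orthogonal complement.
Density is what makes the adjoint characterized by its pairing with `∂̄`. -/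
theorem dense_dbar_domain (hΩ : IsOpen Ω) : Dense ((dbar Ω).domain : Set (L2Forms Ω)) := by
  rw [Submodule.dense_iff_topologicalClosure_eq_top, Submodule.topologicalClosure_eq_top_iff,
    Submodule.eq_bot_iff]
  intro w hw
  have hz : ∀ J : Finset (Fin n), ∀ᵐ z ∂(volume.restrict Ω), w z J = 0 := by
    intro J
    refine ae_eq_zero_of_setIntegral_mul_eq_zero hΩ (L2Forms.locallyIntegrable_coeff w J)
      fun φ hφ => ?_
    obtain ⟨B, W, h, hB, -⟩ := exists_isWeakDbar_smul_const Ω (hφ.conj.mono (Set.subset_univ _))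
      (EuclideanSpace.single J (1 : ℂ))
    rw [← (Submodule.mem_orthogonal _ _).1 hw B h.mem_domain, L2.inner_def]
    refine integral_congr_ae ?_
    filter_upwards [hB] with z hz
    rw [hz, inner_smul_left, EuclideanSpace.inner_single_left]
    simp [mul_comm]
  rw [Lp.eq_zero_iff_ae_eq_zero]
  filter_upwards [ae_all_iff.2 hz] with z hz
  ext J
  exact hz J

theorem inner_dbarStar (hΩ : IsOpen Ω) (U : (dbarStar Ω).domain) {β w : L2Forms Ω}
    (h : IsWeakDbar Ω β w) : ⟪dbarStar Ω U, β⟫_ℂ = ⟪(U : L2Forms Ω), w⟫_ℂ := by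
  have h1 := LinearPMap.adjoint_isFormalAdjoint (dense_dbar_domain hΩ) U ⟨β, h.mem_domain⟩
  rwa [h.dbar_eq hΩ] at h1

theorem inner_compLp_contractOp_left (k : Fin n) (a b : L2Forms Ω) :
    ⟪((contractOp k).compLp a : L2Forms Ω), b⟫_ℂ = ⟪a, ((wedgeOp k).compLp b : L2Forms Ω)⟫_ℂ := by
  rw [L2.inner_def, L2.inner_def]
  refine integral_congr_ae ?_
  filter_upwards [ContinuousLinearMap.coeFn_compLp (contractOp k) a,
    ContinuousLinearMap.coeFn_compLp (wedgeOp k) b] with z h1 h2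
  rw [h1, h2, inner_contractOp_left]

theorem norm_compLp_contractOp_le (k : Fin n) (a : L2Forms Ω) :
    ‖((contractOp k).compLp a : L2Forms Ω)‖ ≤ ‖a‖ := by
  refine Lp.norm_le_norm_of_ae_le ?_
  filter_upwards [ContinuousLinearMap.coeFn_compLp (contractOp k) a] with z hz
  rw [hz]
  exact norm_contractOp_le k _

theorem dbarStar_eq (hΩ : IsOpen Ω) (U : (dbarStar Ω).domain) {w : L2Forms Ω}
    (h : ∀ β : (dbar Ω).domain, ⟪w, β⟫_ℂ = ⟪(U : L2Forms Ω), dbar Ω β⟫_ℂ) :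
    dbarStar Ω U = w :=
  LinearPMap.adjoint_apply_eq (dense_dbar_domain hΩ) U h

/-- Dual to the weak anticommutation of `∂̄` with `dz̄_k ∧ ·`: the value of `∂̄*` on the contraction
is minus the contraction of `∂̄*U`, and contraction does not increase norms. -/
theorem exists_dbarStar_contractOp (hΩ : IsOpen Ω) (U : (dbarStar Ω).domain) (k : Fin n) :
    ∃ V : (dbarStar Ω).domain, (V : L2Forms Ω) = (contractOp k).compLp (U : L2Forms Ω) ∧
      ‖dbarStar Ω V‖ ≤ ‖dbarStar Ω U‖ := by
  have key : ∀ β : (dbar Ω).domain, ⟪-((contractOp k).compLp (dbarStar Ω U) : L2Forms Ω), β⟫_ℂ =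
      ⟪((contractOp k).compLp (U : L2Forms Ω) : L2Forms Ω), dbar Ω β⟫_ℂ := by
    intro β
    have h := inner_dbarStar hΩ U ((isWeakDbar_dbar hΩ β).neg_wedgeOp k)
    rw [inner_neg_right] at h
    rw [inner_neg_left, inner_compLp_contractOp_left, inner_compLp_contractOp_left, h, neg_neg]
  obtain ⟨V, hV⟩ : ∃ V : (dbarStar Ω).domain,
      (V : L2Forms Ω) = (contractOp k).compLp (U : L2Forms Ω) :=
    ⟨⟨_, LinearPMap.mem_adjoint_domain_of_exists _ ⟨_, key⟩⟩, rfl⟩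
  rw [← hV] at key
  refine ⟨V, hV, ?_⟩
  rw [dbarStar_eq hΩ V key, norm_neg]
  exact norm_compLp_contractOp_le k _

theorem Represents.contractOp {u : Cn n → FormVal n} {U : L2Forms Ω} (h : Represents Ω u U)
    (k : Fin n) : Represents Ω (contraction k u) ((contractOp k).compLp U) := by
  filter_upwards [h, ContinuousLinearMap.coeFn_compLp (_root_.contractOp k) U] with z h1 h2
  rw [h2, h1]
  rfl

theorem contDiff_contractOp {m : WithTop ℕ∞} {u : Cn n → FormVal n} (hu : ContDiff ℝ m u)
    (k : Fin n) (K : Finset (Fin n)) : ContDiff ℝ m (fun z => contractOp k (u z) K) :=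
  (((EuclideanSpace.proj K : FormVal n →L[ℂ] ℂ).comp
    (contractOp k)).restrictScalars ℝ).contDiff.comp hu

/-- The adjoint relation tested on `conj ψ · dz̄_K`; the conjugate turns `∂/∂z̄_k` into `∂/∂z_k`. No
condition is put on `ψ` at the boundary. -/
theorem setIntegral_contractOp_mul_dz (hΩ : IsOpen Ω) {u : Cn n → FormVal n}
    {U : (dbarStar Ω).domain} (hU : Represents Ω u U) {ψ : Cn n → ℂ}
    (hψ : IsTestFunction Set.univ ψ) (K : Finset (Fin n)) :
    ∫ z in Ω, ∑ k, contractOp k (u z) K * dz k ψ z = ∫ z in Ω, dbarStar Ω U z K * ψ z := by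
  obtain ⟨B, W, h, hB, hW⟩ := exists_isWeakDbar_smul_const Ω hψ.conj
    (EuclideanSpace.single K (1 : ℂ))
  have h1 := congrArg (starRingEnd ℂ) (inner_dbarStar hΩ U h)
  rw [inner_conj_symm, inner_conj_symm, L2.inner_def, L2.inner_def] at h1
  have hψ1 : ContDiff ℝ 1 ψ := hψ.contDiff.of_le (by simp)
  convert h1.symm using 1
  · refine integral_congr_ae ?_
    filter_upwards [hW, hU] with z h2 h3
    rw [h2, h3, sum_inner]
    refine Finset.sum_congr rfl fun k _ => ?_
    rw [inner_smul_left, inner_wedgeOp_left, EuclideanSpace.inner_single_left,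
      ← dz_eq_conj_dzbar k (hψ1.differentiable one_ne_zero z)]
    simp [mul_comm]
  · refine integral_congr_ae ?_
    filter_upwards [hB] with z h2
    rw [h2, inner_smul_left, EuclideanSpace.inner_single_left]
    simp [mul_comm]

/-- With `ψ` supported inside `Ω` one may integrate by parts freely, so `∂̄*` acts as the formal
adjoint. -/
theorem dbarStar_ae_eq (hΩ : IsOpen Ω) {u : Cn n → FormVal n} (hu : ContDiff ℝ 1 u)
    {U : (dbarStar Ω).domain} (hU : Represents Ω u U) (K : Finset (Fin n)) :
    ∀ᵐ z ∂(volume.restrict Ω), dbarStar Ω U z K = -∑ k, dz k (fun w => contractOp k (u w) K) z := by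
  have hF : ∀ k, ContDiff ℝ 1 (fun w => contractOp k (u w) K) := fun k => contDiff_contractOp hu k K
  have hF' : ∀ k, Continuous (dz k (fun w => contractOp k (u w) K)) := fun k =>
    (ContDiff.dz (m := 0) (by simpa using hF k) k).continuous
  have h := ae_eq_zero_of_setIntegral_mul_eq_zero hΩ (f := fun z => dbarStar Ω U z K +
    ∑ k, dz k (fun w => contractOp k (u w) K) z) ?_ ?_
  · filter_upwards [h] with z hz
    exact eq_neg_of_add_eq_zero_left hz
  · refine (L2Forms.locallyIntegrable_coeff _ K).add ?_
    exact (continuous_finsetSum _ fun k _ => hF' k).locallyIntegrable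
  · intro φ hφ
    have hφ1 : ContDiff ℝ 1 φ := hφ.contDiff.of_le (by simp)
    have hdφ : ∀ k, Continuous (dz k φ) := fun k =>
      (ContDiff.dz (m := 0) (by simpa using hφ1) k).continuous
    have hi : ∀ k, Integrable (fun z => dz k (fun w => contractOp k (u w) K) z * φ z)
        (volume.restrict Ω) := fun k =>
      (((hF' k).mul hφ.contDiff.continuous).integrable_of_hasCompactSupport
        hφ.hasCompactSupport.mul_left).restrict
    have hc : ∀ k, HasCompactSupport (dz k φ) := fun k => by
      have := (hφ.conj.hasCompactSupport_dzbar k).comp_left (g := starRingEnd ℂ) (map_zero _)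
      convert this using 1
      ext z
      exact dz_eq_conj_dzbar k (hφ1.differentiable one_ne_zero z)
    have hi2 : ∀ k, Integrable (fun z => contractOp k (u z) K * dz k φ z)
        (volume.restrict Ω) := fun k =>
      (((hF k).continuous.mul (hdφ k)).integrable_of_hasCompactSupport
        (hc k).mul_left).restrict
    simp_rw [add_mul, Finset.sum_mul]
    rw [integral_add (integrable_coeff_mul _ _ hφ.contDiff.continuous hφ.hasCompactSupport)
      (integrable_finsetSum _ fun k _ => hi k),
      ← setIntegral_contractOp_mul_dz hΩ hU (hφ.mono (Set.subset_univ _)),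
      integral_finsetSum _ fun k _ => hi k, integral_finsetSum _ fun k _ => hi2 k,
      ← Finset.sum_add_distrib]
    refine Finset.sum_eq_zero fun k _ => ?_
    rw [setIntegral_dz_mul (hF k) hφ]
    ring

/-- Comparing the interior formula with the pairing up to the boundary: the flux of `(u_{kK} ψ)_k`
through the boundary vanishes for all `ψ`, an integrated form of the tangential condition. -/
theorem setIntegral_sum_dz_mul_eq_zero (hΩ : IsOpen Ω) {u : Cn n → FormVal n}
    (hu : ContDiff ℝ 1 u) {U : (dbarStar Ω).domain} (hU : Represents Ω u U) {ψ : Cn n → ℂ}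
    (hψ : IsTestFunction Set.univ ψ) (K : Finset (Fin n)) :
    ∫ z in Ω, ∑ k, dz k (fun w => contractOp k (u w) K * ψ w) z = 0 := by
  have hF : ∀ k, ContDiff ℝ 1 (fun w => contractOp k (u w) K) := fun k => contDiff_contractOp hu k K
  have hψ1 : ContDiff ℝ 1 ψ := hψ.contDiff.of_le (by simp)
  have h1 : ∫ z in Ω, ∑ k, dz k (fun w => contractOp k (u w) K * ψ w) z =
      ∫ z in Ω, (∑ k, contractOp k (u z) K * dz k ψ z - dbarStar Ω U z K * ψ z) := by
    refine integral_congr_ae ?_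
    filter_upwards [dbarStar_ae_eq hΩ hu hU K] with z hz
    rw [hz, neg_mul, sub_neg_eq_add, Finset.sum_mul, ← Finset.sum_add_distrib]
    refine Finset.sum_congr rfl fun k _ => ?_
    rw [dz_mul k ((hF k).differentiable one_ne_zero z) (hψ1.differentiable one_ne_zero z), add_comm]
  rw [h1, integral_sub, setIntegral_contractOp_mul_dz hΩ hU hψ, sub_self]
  · refine integrable_finsetSum _ fun k _ => ?_
    have hc : HasCompactSupport (dz k ψ) := by
      have := (hψ.conj.hasCompactSupport_dzbar k).comp_left (g := starRingEnd ℂ) (map_zero _)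
      convert this using 1
      ext z
      exact dz_eq_conj_dzbar k (hψ1.differentiable one_ne_zero z)
    exact (((hF k).continuous.mul
      (ContDiff.dz (m := 0) (by simpa using hψ1) k).continuous).integrable_of_hasCompactSupport
        hc.mul_left).restrict
  · exact integrable_coeff_mul _ _ hψ.contDiff.continuous hψ.hasCompactSupport

end AdjointDomain

/-- A smooth function `r` on `ℂⁿ` with `Ω = {r < 0}`, and with `dr ≠ 0` on the boundary of `Ω`. -/
structure IsGlobalDefiningFunction {n : ℕ} (Ω : Set (Cn n)) (r : Cn n → ℝ) : Prop where
  contDiff : ContDiff ℝ ∞ r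
  mem_iff : ∀ z, z ∈ Ω ↔ r z < 0
  fderiv_ne_zero : ∀ z ∈ frontier Ω, fderiv ℝ r z ≠ 0

/-! ### Global defining functions and comparison with `r` near the boundary -/

section DefiningFunction

open Filter Topology

variable {n : ℕ} {Ω : Set (Cn n)}

/-- Multiply `ρ` by a cutoff with values in `[0, 1]` that is 1 near the closure of `Ω` and 0 near
the complement of `U`. Nonnegativity of the cutoff creates no new points with `r < 0`. -/
theorem IsDefiningFunction.exists_global {ρ : Cn n → ℝ} (hρ : IsDefiningFunction Ω ρ) :
    ∃ r : Cn n → ℝ, IsGlobalDefiningFunction Ω r ∧ ∀ z ∈ closure Ω, r =ᶠ[𝓝 z] ρ := by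
  obtain ⟨⟨U, hU, hΩU, hs, hΩ⟩, hg⟩ := hρ
  obtain ⟨f, h0, h1, hf⟩ := exists_contMDiffMap_zero_one_nhds_of_isClosed (n := ⊤)
    (modelWithCornersSelf ℝ (Cn n)) hU.isClosed_compl (isClosed_closure (s := Ω))
    (Set.disjoint_left.2 fun z hz hz' => hz (hΩU hz'))
  have heq : ∀ z ∈ closure Ω, (fun z => f z * ρ z) =ᶠ[𝓝 z] ρ := by
    intro z hz
    filter_upwards [h1.filter_mono (nhds_le_nhdsSet hz)] with w hw
    rw [hw, one_mul]
  refine ⟨fun z => f z * ρ z, ⟨?_, ?_, ?_⟩, heq⟩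
  · refine contDiff_iff_contDiffAt.2 fun z => ?_
    by_cases hz : z ∈ U
    · exact f.contMDiff.contDiff.contDiffAt.mul (hs.contDiffAt (hU.mem_nhds hz))
    · refine (contDiffAt_const (c := (0 : ℝ))).congr_of_eventuallyEq ?_
      filter_upwards [h0.filter_mono (nhds_le_nhdsSet hz)] with w hw
      rw [hw, zero_mul]
  · intro z
    constructor
    · intro hz
      rw [(heq z (subset_closure hz)).eq_of_nhds]
      rw [hΩ] at hz
      exact hz.2
    · intro hz
      by_contra hzΩ
      by_cases hzU : z ∈ U
      · have : 0 ≤ ρ z := by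
          by_contra h
          rw [hΩ] at hzΩ
          exact hzΩ ⟨hzU, not_le.1 h⟩
        exact absurd hz (not_lt.2 (mul_nonneg (hf z).1 this))
      · have : f z = 0 := h0.self_of_nhdsSet z hzU
        simp [this] at hz
  · intro z hz h
    refine hg z hz ?_
    rw [gradient, ← (heq z (frontier_subset_closure hz)).fderiv_eq, h, map_zero]

namespace IsGlobalDefiningFunction

variable {r : Cn n → ℝ} (hr : IsGlobalDefiningFunction Ω r)

include hr

theorem isOpen : IsOpen Ω := by
  have : Ω = r ⁻¹' Set.Iio 0 := Set.ext hr.mem_iff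
  rw [this]
  exact isOpen_Iio.preimage hr.contDiff.continuous

theorem nonneg_of_notMem {z : Cn n} (hz : z ∉ Ω) : 0 ≤ r z := by
  rwa [hr.mem_iff, not_lt] at hz

theorem nonpos_of_mem_closure {z : Cn n} (hz : z ∈ closure Ω) : r z ≤ 0 :=
  closure_minimal (fun w hw => ((hr.mem_iff w).1 hw).le)
    (isClosed_Iic.preimage hr.contDiff.continuous) hz

theorem eq_zero {z : Cn n} (hz : z ∈ frontier Ω) : r z = 0 := by
  rw [hr.isOpen.frontier_eq] at hz
  exact le_antisymm (hr.nonpos_of_mem_closure hz.1) (hr.nonneg_of_notMem hz.2)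

theorem exists_frontier_mem_segment {x y : Cn n} (hx : x ∈ Ω) (hy : y ∉ Ω) :
    ∃ z ∈ segment ℝ x y, z ∈ frontier Ω := by
  by_contra! h
  have hyc : y ∈ (closure Ω)ᶜ := fun hyc => h y (right_mem_segment ℝ x y) (by
    rw [hr.isOpen.frontier_eq]
    exact ⟨hyc, hy⟩)
  obtain ⟨z, -, hz1, hz2⟩ := (convex_segment x y).isPreconnected Ω (closure Ω)ᶜ hr.isOpen
    isClosed_closure.isOpen_compl (fun z hz => by
      by_cases hzΩ : z ∈ Ω
      · exact Or.inl hzΩ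
      · refine Or.inr fun hzc => h z hz ?_
        rw [hr.isOpen.frontier_eq]
        exact ⟨hzc, hzΩ⟩) ⟨x, left_mem_segment ℝ x y, hx⟩ ⟨y, right_mem_segment ℝ x y, hyc⟩
  exact hz2 (subset_closure hz1)

theorem exists_fderiv_eq_one {p : Cn n} (hp : p ∈ frontier Ω) : ∃ e, fderiv ℝ r p e = 1 := by
  obtain ⟨v, hv⟩ : ∃ v, fderiv ℝ r p v ≠ 0 := by
    by_contra! h
    exact hr.fderiv_ne_zero p hp (ContinuousLinearMap.ext h)
  exact ⟨(fderiv ℝ r p v)⁻¹ • v, by simp [hv]⟩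

/-- From `z ∈ Ω` near `p`, walking for time `-2 * r z` along `e` with `dr(e) = 1` leaves `Ω`. So a
boundary point lies within `2 ‖e‖ |r z|` of `z`; there `E ≥ 0`, and the Lipschitz bound for `E`
gives the claim. -/
theorem exists_local_lower_bound {E : Cn n → ℝ} (hE : ContDiff ℝ 1 E)
    (hE0 : ∀ z ∈ frontier Ω, 0 ≤ E z) {p : Cn n} (hp : p ∈ frontier Ω) :
    ∃ N ∈ 𝓝 p, ∃ C : ℝ, 0 ≤ C ∧ ∀ z ∈ N, z ∈ Ω → C * r z ≤ E z := by
  obtain ⟨e, he⟩ := hr.exists_fderiv_eq_one hp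
  have he0 : 0 < ‖e‖ := by
    rw [norm_pos_iff]
    rintro rfl
    simp at he
  have hst : HasStrictFDerivAt r (fderiv ℝ r p) p :=
    hr.contDiff.contDiffAt.hasStrictFDerivAt (by simp)
  obtain ⟨K, T, hT, hK⟩ := (hE.contDiffAt (x := p)).exists_lipschitzOnWith
  -- This constant makes the linearization error at most half the growth of `r` along `e`.
  have hst2 := hst.isLittleO.def (c := 1 / (2 * ‖e‖)) (by positivity)
  rw [nhds_prod_eq, Filter.Eventually, mem_prod_self_iff] at hst2
  obtain ⟨S, hS, hS1⟩ := hst2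
  have hS2 : ∀ x ∈ S, ∀ y ∈ S,
      ‖r x - r y - fderiv ℝ r p (x - y)‖ ≤ 1 / (2 * ‖e‖) * ‖x - y‖ := fun x hx y hy =>
    hS1 (Set.mk_mem_prod hx hy)
  obtain ⟨s, hs, hsb⟩ := Metric.mem_nhds_iff.1 (inter_mem hT hS)
  have hrc : ∀ᶠ z in 𝓝 p, |r z| < s / (4 * ‖e‖) := by
    have : Tendsto (fun z => |r z|) (𝓝 p) (𝓝 |r p|) := (hr.contDiff.continuous.abs).tendsto p
    rw [hr.eq_zero hp, abs_zero] at this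
    exact this.eventually_lt_const (by positivity)
  refine ⟨_, inter_mem (Metric.ball_mem_nhds p (half_pos hs)) hrc, K * (2 * ‖e‖), by positivity, ?_⟩
  rintro z ⟨hz1, hz2⟩ hzΩ
  have hrz : r z < 0 := (hr.mem_iff z).1 hzΩ
  have hz2' : -r z * (4 * ‖e‖) < s := by
    have : |r z| < s / (4 * ‖e‖) := hz2
    rwa [abs_of_neg hrz, lt_div_iff₀ (by positivity)] at this
  have hball : ∀ t ∈ Set.Icc (0 : ℝ) (-2 * r z), z + t • e ∈ Metric.ball p s := by
    intro t ht
    rw [Metric.mem_ball, dist_eq_norm] at hz1 ⊢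
    calc ‖z + t • e - p‖ = ‖(z - p) + t • e‖ := by congr 1; abel
      _ ≤ ‖z - p‖ + ‖t • e‖ := norm_add_le _ _
      _ = ‖z - p‖ + t * ‖e‖ := by rw [norm_smul, Real.norm_of_nonneg ht.1]
      _ < s := by nlinarith [mul_le_mul_of_nonneg_right ht.2 he0.le]
  have hz0 : z ∈ Metric.ball p s := by simpa using hball 0 ⟨le_rfl, by linarith⟩
  -- The linear gain is `-2 * r z` and the error at most `-r z`, so `r` reaches at least 0.
  have hout : z + (-2 * r z) • e ∉ Ω := by
    rw [hr.mem_iff, not_lt]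
    have h := hS2 _ (hsb (hball (-2 * r z) ⟨by linarith, le_rfl⟩)).2 _ (hsb hz0).2
    simp only [add_sub_cancel_left, map_smul, he, smul_eq_mul, mul_one, norm_smul] at h
    rw [Real.norm_of_nonneg (by linarith : 0 ≤ -2 * r z)] at h
    have h2 : 1 / (2 * ‖e‖) * (-2 * r z * ‖e‖) = -r z := by
      field_simp
    rw [h2] at h
    have := neg_le_of_abs_le h
    linarith
  obtain ⟨y, hy, hyf⟩ := hr.exists_frontier_mem_segment hzΩ hout
  rw [segment_eq_image'] at hy
  obtain ⟨θ, hθ, rfl⟩ := hy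
  have hy2 : z + θ • (z + (-2 * r z) • e - z) = z + (θ * (-2 * r z)) • e := by
    rw [add_sub_cancel_left, smul_smul]
  beta_reduce at hyf
  rw [hy2] at hyf
  have hθ2 : θ * (-2 * r z) ∈ Set.Icc (0 : ℝ) (-2 * r z) :=
    ⟨mul_nonneg hθ.1 (by linarith), by nlinarith [hθ.2]⟩
  have hL := hK.dist_le_mul _ (hsb (hball _ hθ2)).1 _ (hsb hz0).1
  rw [dist_eq_norm, dist_eq_norm, add_sub_cancel_left, norm_smul, Real.norm_of_nonneg hθ2.1,
    Real.norm_eq_abs] at hL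
  have h3 := le_of_abs_le hL
  have h4 := hE0 _ hyf
  have h5 : (K : ℝ) * (θ * (-2 * r z) * ‖e‖) ≤ K * (-2 * r z * ‖e‖) := by
    exact mul_le_mul_of_nonneg_left (mul_le_mul_of_nonneg_right hθ2.2 he0.le) K.2
  nlinarith

/-- A function of class `C¹` that is nonnegative on the boundary is bounded below by a multiple of
the defining function. -/
theorem exists_lower_bound (hb : Bornology.IsBounded Ω) {E : Cn n → ℝ} (hE : ContDiff ℝ 1 E)
    (hE0 : ∀ z ∈ frontier Ω, 0 ≤ E z) : ∃ C : ℝ, 0 ≤ C ∧ ∀ z ∈ Ω, C * r z ≤ E z := by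
  have hc : IsCompact (closure Ω) := hb.isCompact_closure
  suffices h : ∃ C : ℝ, 0 ≤ C ∧ ∀ z ∈ closure Ω, z ∈ Ω → C * r z ≤ E z by
    obtain ⟨C, hC, h⟩ := h
    exact ⟨C, hC, fun z hz => h z (subset_closure hz) hz⟩
  refine hc.induction_on
    (p := fun s => ∃ C : ℝ, 0 ≤ C ∧ ∀ z ∈ s, z ∈ Ω → C * r z ≤ E z) ?_ ?_ ?_ ?_
  · exact ⟨0, le_rfl, fun z hz => absurd hz (Set.notMem_empty z)⟩
  · rintro s t hst ⟨C, hC, h⟩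
    exact ⟨C, hC, fun z hz => h z (hst hz)⟩
  · rintro s t ⟨C, hC, h⟩ ⟨D, hD, h'⟩
    refine ⟨max C D, le_max_of_le_left hC, fun z hz hzΩ => ?_⟩
    have hrz := ((hr.mem_iff z).1 hzΩ).le
    rcases hz with hz | hz
    · exact (mul_le_mul_of_nonpos_right (le_max_left _ _) hrz).trans (h z hz hzΩ)
    · exact (mul_le_mul_of_nonpos_right (le_max_right _ _) hrz).trans (h' z hz hzΩ)
  · intro p hp
    by_cases hpΩ : p ∈ Ω
    · have hrp : r p < 0 := (hr.mem_iff p).1 hpΩ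
      have h1 : ∀ᶠ z in 𝓝 p, r z < r p / 2 :=
        (hr.contDiff.continuous.tendsto p).eventually_lt_const (by linarith)
      have h2 : ∀ᶠ z in 𝓝 p, E p - 1 < E z :=
        (hE.continuous.tendsto p).eventually_const_lt (by linarith)
      -- Near an interior point `r` stays below a negative constant; this choice of `C` forces `C *
      -- r z ≤ -(|E p| + 1) ≤ E p - 1`.
      refine ⟨_, mem_nhdsWithin_of_mem_nhds (inter_mem h1 h2), (|E p| + 1) / (-(r p / 2)), ?_, ?_⟩
      · exact div_nonneg (by positivity) (by linarith)
      · rintro z ⟨hz1, hz2⟩ -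
        have hz1 : r z < r p / 2 := hz1
        have hz2 : E p - 1 < E z := hz2
        have h3 : (|E p| + 1) / (-(r p / 2)) * r z ≤ (|E p| + 1) / (-(r p / 2)) * (r p / 2) :=
          mul_le_mul_of_nonneg_left hz1.le (div_nonneg (by positivity) (by linarith))
        have h4 : (|E p| + 1) / (-(r p / 2)) * (r p / 2) = -(|E p| + 1) := by
          have := hrp.ne
          rw [div_neg, neg_mul, div_mul_cancel₀ _ (by linarith)]
        linarith [neg_abs_le (E p)]
    · obtain ⟨N, hN, C, hC, h⟩ := hr.exists_local_lower_bound hE hE0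
        (by rw [hr.isOpen.frontier_eq]; exact ⟨hp, hpΩ⟩)
      exact ⟨N, mem_nhdsWithin_of_mem_nhds hN, C, hC, h⟩

/-- On a ray entering `Ω` the lower bound applied to `-h` reads `h ≤ -C r`; divide by the time and
let it tend to 0. -/
theorem fderiv_apply_le {h : Cn n → ℝ} (hh : ContDiff ℝ 1 h) (hb : Bornology.IsBounded Ω)
    (h0 : ∀ z ∈ frontier Ω, h z = 0) {p : Cn n} (hp : p ∈ frontier Ω) :
    ∃ C : ℝ, ∀ w, fderiv ℝ r p w < 0 → fderiv ℝ h p w ≤ -(C * fderiv ℝ r p w) := by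
  obtain ⟨C, -, hC⟩ := hr.exists_lower_bound hb hh.neg (fun z hz => by simp [h0 z hz])
  refine ⟨C, fun w hw => ?_⟩
  have hline : HasDerivAt (fun t : ℝ => p + t • w) w 0 := by
    simpa using ((hasDerivAt_id (0 : ℝ)).smul_const w).const_add p
  have hd : ∀ f : Cn n → ℝ, ContDiff ℝ 1 f →
      HasDerivAt (fun t : ℝ => f (p + t • w)) (fderiv ℝ f p w) 0 := by
    intro f hf
    have := (hf.differentiable one_ne_zero p).hasFDerivAt
    refine HasFDerivAt.comp_hasDerivAt (0 : ℝ) (f := fun t : ℝ => p + t • w) (l := f) ?_ hline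
    simpa using this
  have h1 := (hd r (hr.contDiff.of_le (by simp))).tendsto_slope_zero_right
  have h2 := (hd h hh).tendsto_slope_zero_right
  simp only [zero_add, zero_smul, add_zero, hr.eq_zero hp, h0 p hp, sub_zero, smul_eq_mul] at h1 h2
  refine le_of_tendsto_of_tendsto h2 (h1.const_mul C).neg ?_
  filter_upwards [h1.eventually_lt_const hw, self_mem_nhdsWithin] with t ht ht0
  have ht0 : 0 < t := ht0
  have h3 : p + t • w ∈ Ω := by
    rw [hr.mem_iff]
    by_contra hcon
    exact absurd ht (not_lt.2 (mul_nonneg (inv_nonneg.2 ht0.le) (not_lt.1 hcon)))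
  have h4 : C * r (p + t • w) ≤ -h (p + t • w) := hC _ h3
  have h5 : 0 ≤ t⁻¹ * (-h (p + t • w) - C * r (p + t • w)) :=
    mul_nonneg (inv_nonneg.2 ht0.le) (by linarith)
  linarith

/-- A tangent vector is the limit of the inward vectors `v - s • e`, for which the bound is `O(s)`.
The opposite inequality comes from `-h`. -/
theorem fderiv_eq_zero_of_tangent {h : Cn n → ℝ} (hh : ContDiff ℝ 1 h)
    (hb : Bornology.IsBounded Ω) (h0 : ∀ z ∈ frontier Ω, h z = 0) {p : Cn n}
    (hp : p ∈ frontier Ω) {v : Cn n} (hv : fderiv ℝ r p v = 0) : fderiv ℝ h p v ≤ 0 := by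
  obtain ⟨C, hC⟩ := hr.fderiv_apply_le hh hb h0 hp
  obtain ⟨e, he⟩ := hr.exists_fderiv_eq_one hp
  have h1 : ∀ᶠ s : ℝ in 𝓝[>] 0, fderiv ℝ h p v ≤ s * (C + fderiv ℝ h p e) := by
    filter_upwards [self_mem_nhdsWithin] with s hs
    have := hC (v - s • e) (by
      have hs : 0 < s := hs
      simp [hv, he, hs])
    simp [hv, he] at this
    linarith
  have h2 : Tendsto (fun s : ℝ => s * (C + fderiv ℝ h p e)) (𝓝[>] 0) (𝓝 0) := by
    have : Tendsto (fun s : ℝ => s * (C + fderiv ℝ h p e)) (𝓝 0)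
        (𝓝 (0 * (C + fderiv ℝ h p e))) := (continuous_id.mul continuous_const).tendsto 0
    rw [zero_mul] at this
    exact this.mono_left nhdsWithin_le_nhds
  exact ge_of_tendsto h2 h1

/-- The differential of a function vanishing on the boundary is a multiple of `dr` there. -/
theorem exists_fderiv_eq_mul (hb : Bornology.IsBounded Ω) {G : Cn n → ℂ} (hG : ContDiff ℝ 1 G)
    (hG0 : ∀ z ∈ frontier Ω, G z = 0) {p : Cn n} (hp : p ∈ frontier Ω) :
    ∃ c : ℂ, ∀ v, fderiv ℝ G p v = c * fderiv ℝ r p v := by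
  obtain ⟨e, he⟩ := hr.exists_fderiv_eq_one hp
  have key : ∀ L : ℂ →L[ℝ] ℝ, ∀ v, fderiv ℝ r p v = 0 → L (fderiv ℝ G p v) ≤ 0 := by
    intro L v hv
    have h1 := hr.fderiv_eq_zero_of_tangent (h := fun z => L (G z)) (L.contDiff.comp hG) hb
      (fun z hz => by simp [hG0 z hz]) hp hv
    have h2 : fderiv ℝ (fun z => L (G z)) p = L.comp (fderiv ℝ G p) :=
      (L.hasFDerivAt.comp p (hG.differentiable one_ne_zero p).hasFDerivAt).fderiv
    rwa [h2] at h1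
  have key2 : ∀ v, fderiv ℝ r p v = 0 → fderiv ℝ G p v = 0 := by
    intro v hv
    refine Complex.ext (le_antisymm (key Complex.reCLM v hv) ?_)
      (le_antisymm (key Complex.imCLM v hv) ?_)
    · simpa using key (-Complex.reCLM) v hv
    · simpa using key (-Complex.imCLM) v hv
  -- As `dr(e) = 1`, the vector `v - dr(v) e` is tangent and is killed by `dG`.
  refine ⟨fderiv ℝ G p e, fun v => ?_⟩
  have := key2 (v - fderiv ℝ r p v • e) (by simp [he])
  rw [map_sub, map_smul, sub_eq_zero] at this
  rw [this, Complex.real_smul, mul_comm]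

end IsGlobalDefiningFunction

end DefiningFunction

/-! Boundary integrals as limits of integrals over thin shells. -/

section Cutoff

open Filter Topology

theorem deriv_smoothTransition_of_nonpos {t : ℝ} (ht : t ≤ 0) :
    deriv Real.smoothTransition t = 0 := by
  refine IsLocalMin.deriv_eq_zero (Eventually.of_forall fun s => ?_)
  rw [Real.smoothTransition.zero_of_nonpos ht]
  exact Real.smoothTransition.nonneg s

theorem deriv_smoothTransition_of_one_le {t : ℝ} (ht : 1 ≤ t) :
    deriv Real.smoothTransition t = 0 := by
  refine IsLocalMax.deriv_eq_zero (Eventually.of_forall fun s => ?_)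
  rw [Real.smoothTransition.one_of_one_le ht]
  exact Real.smoothTransition.le_one s

theorem deriv_smoothTransition_nonneg (t : ℝ) : 0 ≤ deriv Real.smoothTransition t :=
  Real.smoothTransition.monotone.deriv_nonneg

theorem continuous_deriv_smoothTransition : Continuous (deriv Real.smoothTransition) :=
  (Real.smoothTransition.contDiff (n := 1)).continuous_deriv le_rfl

/-- With `t = -r z / δ` this bounds `shellDensity r δ z * r z` uniformly in `δ`. -/
theorem exists_bound_deriv_smoothTransition :
    ∃ M : ℝ, ∀ t, |t * deriv Real.smoothTransition t| ≤ M := by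
  have hc : HasCompactSupport fun t : ℝ => t * deriv Real.smoothTransition t := by
    refine HasCompactSupport.intro (isCompact_Icc (a := (0 : ℝ)) (b := 1)) fun t ht => ?_
    rw [Set.mem_Icc, not_and_or, not_le, not_le] at ht
    rcases ht with ht | ht
    · rw [deriv_smoothTransition_of_nonpos ht.le, mul_zero]
    · rw [deriv_smoothTransition_of_one_le ht.le, mul_zero]
  obtain ⟨M, hM⟩ := hc.exists_bound_of_continuous
    (continuous_id.mul continuous_deriv_smoothTransition)
  exact ⟨M, hM⟩

theorem Continuous.integrable_restrict_of_isBounded {n : ℕ} {Ω : Set (Cn n)}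
    (hb : Bornology.IsBounded Ω) {E : Type*} [NormedAddCommGroup E]
    {f : Cn n → E} (hf : Continuous f) : Integrable f (volume.restrict Ω) :=
  (hf.continuousOn.integrableOn_compact hb.isCompact_closure).mono_set subset_closure

/-- A density concentrated on the shell `{-δ < r < 0}`; as `δ → 0` it converges to the surface
measure of the boundary, divided by `|∇r|`. -/
noncomputable def shellDensity {n : ℕ} (r : Cn n → ℝ) (δ : ℝ) (z : Cn n) : ℝ :=
  deriv Real.smoothTransition (-r z / δ) / δ

namespace IsGlobalDefiningFunction

variable {n : ℕ} {Ω : Set (Cn n)} {r : Cn n → ℝ} (hr : IsGlobalDefiningFunction Ω r)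

include hr

theorem continuous_shellDensity (δ : ℝ) : Continuous (shellDensity r δ) :=
  (continuous_deriv_smoothTransition.comp (hr.contDiff.continuous.neg.div_const δ)).div_const δ

theorem tendsto_cutoff {z : Cn n} (hz : z ∈ Ω) :
    ∀ᶠ δ : ℝ in 𝓝[>] 0, 1 ≤ -r z / δ := by
  have hrz := (hr.mem_iff z).1 hz
  have h : ∀ᶠ δ : ℝ in 𝓝[>] 0, δ < -r z :=
    (eventually_lt_nhds (by linarith)).filter_mono nhdsWithin_le_nhds
  filter_upwards [h, self_mem_nhdsWithin] with δ h1 h2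
  have h2 : 0 < δ := h2
  rw [le_div_iff₀ h2]
  linarith

/-- The cutoff `S(-r/δ)` vanishes outside `Ω` and has differential `-shellDensity · dr`; integrate
the derivative of cutoff times `f` over `ℂⁿ`. -/
theorem setIntegral_shellDensity_mul (hb : Bornology.IsBounded Ω) {f : Cn n → ℂ}
    (hf : ContDiff ℝ 1 f) (v : Cn n) {δ : ℝ} (hδ : 0 < δ) :
    ∫ z in Ω, (shellDensity r δ z : ℂ) * (fderiv ℝ r z v * f z) =
      ∫ z in Ω, (Real.smoothTransition (-r z / δ) : ℂ) * fderiv ℝ f z v := by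
  have hr1 : ContDiff ℝ 1 r := hr.contDiff.of_le (by simp)
  have hS : ContDiff ℝ 1 fun z => (Real.smoothTransition (-r z / δ) : ℂ) :=
    Complex.ofRealCLM.contDiff.comp
      ((Real.smoothTransition.contDiff (n := 1)).comp (hr1.neg.div_const δ))
  have hzero : ∀ z ∉ Ω, -r z / δ ≤ 0 := fun z hz =>
    div_nonpos_of_nonpos_of_nonneg (by linarith [hr.nonneg_of_notMem hz]) hδ.le
  have hc : HasCompactSupport fun z => (Real.smoothTransition (-r z / δ) : ℂ) := by
    refine HasCompactSupport.intro hb.isCompact_closure fun z hz => ?_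
    rw [Real.smoothTransition.zero_of_nonpos (hzero z fun h => hz (subset_closure h)),
      Complex.ofReal_zero]
  have hdS : ∀ z, fderiv ℝ (fun z => (Real.smoothTransition (-r z / δ) : ℂ)) z v =
      -((shellDensity r δ z : ℂ) * fderiv ℝ r z v) := by
    intro z
    have h1 : HasDerivAt Real.smoothTransition (deriv Real.smoothTransition (-r z / δ)) (-r z / δ) :=
      ((Real.smoothTransition.contDiff (n := 1)).differentiable one_ne_zero _).hasDerivAt
    have h2 : HasFDerivAt (fun z => -r z / δ) (δ⁻¹ • -fderiv ℝ r z) z := by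
      have := ((hr1.differentiable one_ne_zero z).hasFDerivAt.neg).const_mul δ⁻¹
      refine this.congr_of_eventuallyEq (Eventually.of_forall fun w => ?_)
      simp [div_eq_inv_mul]
    have h3 := Complex.ofRealCLM.hasFDerivAt.comp z (h1.comp_hasFDerivAt z h2)
    have h4 := congrArg (fun L : Cn n →L[ℝ] ℂ => L v) h3.fderiv
    refine h4.trans ?_
    simp [shellDensity]
    ring
  have h0 := integral_fderiv_apply_eq_zero (hS.mul hf) hc.mul_right v
  have h1 : ∀ z, fderiv ℝ (fun z => (Real.smoothTransition (-r z / δ) : ℂ) * f z) z v =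
      (Real.smoothTransition (-r z / δ) : ℂ) * fderiv ℝ f z v -
        (shellDensity r δ z : ℂ) * (fderiv ℝ r z v * f z) := by
    intro z
    rw [fderiv_fun_mul (hS.differentiable one_ne_zero z) (hf.differentiable one_ne_zero z)]
    simp only [add_apply, smul_apply, smul_eq_mul, hdS]
    ring
  have hfd : Continuous fun z => fderiv ℝ f z v :=
    (hf.continuous_fderiv one_ne_zero).clm_apply continuous_const
  have hrd : Continuous fun z => (fderiv ℝ r z v : ℂ) :=
    Complex.continuous_ofReal.comp ((hr1.continuous_fderiv one_ne_zero).clm_apply continuous_const)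
  have hw : Continuous fun z => (shellDensity r δ z : ℂ) :=
    Complex.continuous_ofReal.comp (hr.continuous_shellDensity δ)
  refine (sub_eq_zero.1 ?_).symm
  have i1 : Integrable (fun z => (Real.smoothTransition (-r z / δ) : ℂ) * fderiv ℝ f z v)
      (volume.restrict Ω) :=
    Continuous.integrable_restrict_of_isBounded hb (hS.continuous.mul hfd)
  have i2 : Integrable (fun z => (shellDensity r δ z : ℂ) * (fderiv ℝ r z v * f z))
      (volume.restrict Ω) :=
    Continuous.integrable_restrict_of_isBounded hb (hw.mul (hrd.mul hf.continuous))
  rw [← integral_sub i1 i2, setIntegral_eq_integral_of_forall_compl_eq_zero]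
  · simp_rw [← h1]
    exact h0
  · intro z hz
    rw [Real.smoothTransition.zero_of_nonpos (hzero z hz), shellDensity,
      deriv_smoothTransition_of_nonpos (hzero z hz)]
    simp

/-- The divergence theorem on `Ω`, the boundary integral being a limit of integrals over shells. -/
theorem tendsto_setIntegral_shellDensity (hb : Bornology.IsBounded Ω) {f : Cn n → ℂ}
    (hf : ContDiff ℝ 1 f) (v : Cn n) :
    Tendsto (fun δ => ∫ z in Ω, (shellDensity r δ z : ℂ) * (fderiv ℝ r z v * f z)) (𝓝[>] 0)
      (𝓝 (∫ z in Ω, fderiv ℝ f z v)) := by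
  have hfd : Continuous fun z => fderiv ℝ f z v :=
    (hf.continuous_fderiv one_ne_zero).clm_apply continuous_const
  have hS : ∀ δ : ℝ, Continuous fun z => (Real.smoothTransition (-r z / δ) : ℂ) := fun δ =>
    Complex.continuous_ofReal.comp
      (Real.smoothTransition.continuous.comp (hr.contDiff.continuous.neg.div_const δ))
  have h : Tendsto (fun δ : ℝ => ∫ z in Ω, (Real.smoothTransition (-r z / δ) : ℂ) * fderiv ℝ f z v)
      (𝓝[>] 0) (𝓝 (∫ z in Ω, fderiv ℝ f z v)) := by
    refine tendsto_integral_filter_of_dominated_convergence (fun z => ‖fderiv ℝ f z v‖) ?_ ?_ ?_ ?_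
    · exact Eventually.of_forall fun δ => ((hS δ).mul hfd).aestronglyMeasurable
    · refine Eventually.of_forall fun δ => Eventually.of_forall fun z => ?_
      rw [norm_mul, Complex.norm_real, Real.norm_of_nonneg (Real.smoothTransition.nonneg _)]
      exact mul_le_of_le_one_left (norm_nonneg _) (Real.smoothTransition.le_one _)
    · exact Continuous.integrable_restrict_of_isBounded hb hfd.norm
    · filter_upwards [ae_restrict_mem hr.isOpen.measurableSet] with z hz
      refine tendsto_const_nhds.congr' ?_
      filter_upwards [hr.tendsto_cutoff hz] with δ hδ
      rw [Real.smoothTransition.one_of_one_le hδ, Complex.ofReal_one, one_mul]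
  refine h.congr' ?_
  filter_upwards [self_mem_nhdsWithin] with δ hδ
  exact (hr.setIntegral_shellDensity_mul hb hf v hδ).symm

/-- Dominated convergence: the integrand is bounded uniformly in `δ`, and each point of `Ω`
eventually lies outside the shell. -/
theorem tendsto_setIntegral_shellDensity_mul_self (hb : Bornology.IsBounded Ω) :
    Tendsto (fun δ => ∫ z in Ω, shellDensity r δ z * r z) (𝓝[>] 0) (𝓝 0) := by
  obtain ⟨M, hM⟩ := exists_bound_deriv_smoothTransition
  have h : Tendsto (fun δ => ∫ z in Ω, shellDensity r δ z * r z) (𝓝[>] 0)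
      (𝓝 (∫ z in Ω, (0 : ℝ))) := by
    refine tendsto_integral_filter_of_dominated_convergence (fun _ => M) ?_ ?_ ?_ ?_
    · exact Eventually.of_forall fun δ =>
        ((hr.continuous_shellDensity δ).mul hr.contDiff.continuous).aestronglyMeasurable
    · refine Eventually.of_forall fun δ => Eventually.of_forall fun z => ?_
      have h1 : shellDensity r δ z * r z =
          -((-r z / δ) * deriv Real.smoothTransition (-r z / δ)) := by
        rw [shellDensity]
        ring
      rw [h1, norm_neg]
      exact hM _
    · exact Continuous.integrable_restrict_of_isBounded hb continuous_const
    · filter_upwards [ae_restrict_mem hr.isOpen.measurableSet] with z hz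
      refine tendsto_const_nhds.congr' ?_
      filter_upwards [hr.tendsto_cutoff hz] with δ hδ
      rw [shellDensity, deriv_smoothTransition_of_one_le hδ]
      simp
  simpa using h

/-- Inside the shell `E` may be negative, but only down to `C * r`, whose shell integrals tend to 0.
-/
theorem nonneg_of_tendsto_shellDensity (hb : Bornology.IsBounded Ω) {E : Cn n → ℝ}
    (hE : ContDiff ℝ 1 E) (hE0 : ∀ z ∈ frontier Ω, 0 ≤ E z) {L : ℝ}
    (hL : Tendsto (fun δ => ∫ z in Ω, shellDensity r δ z * E z) (𝓝[>] 0) (𝓝 L)) : 0 ≤ L := by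
  obtain ⟨C, -, hC⟩ := hr.exists_lower_bound hb hE hE0
  have h := (hr.tendsto_setIntegral_shellDensity_mul_self hb).const_mul C
  rw [mul_zero] at h
  refine le_of_tendsto_of_tendsto h hL ?_
  filter_upwards [self_mem_nhdsWithin] with δ hδ
  have hδ : 0 < δ := hδ
  rw [← integral_const_mul]
  have hw := hr.continuous_shellDensity δ
  refine setIntegral_mono_on
    (Continuous.integrable_restrict_of_isBounded hb (continuous_const.mul (hw.mul hr.contDiff.continuous)))
    (Continuous.integrable_restrict_of_isBounded hb (hw.mul hE.continuous)) hr.isOpen.measurableSet fun z hz => ?_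
  calc C * (shellDensity r δ z * r z) = shellDensity r δ z * (C * r z) := by ring
    _ ≤ _ := mul_le_mul_of_nonneg_left (hC z hz)
      (div_nonneg (deriv_smoothTransition_nonneg _) hδ.le)

theorem fderiv_toComplex (z v : Cn n) : fderiv ℝ (toComplex r) z v = (fderiv ℝ r z v : ℂ) := by
  have h := Complex.ofRealCLM.hasFDerivAt.comp z
    ((hr.contDiff.differentiable (by simp)) z).hasFDerivAt
  exact congrArg (fun L : Cn n →L[ℝ] ℂ => L v) h.fderiv

theorem tendsto_setIntegral_dz (hb : Bornology.IsBounded Ω) {f : Cn n → ℂ}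
    (hf : ContDiff ℝ 1 f) (k : Fin n) :
    Tendsto (fun δ => ∫ z in Ω, (shellDensity r δ z : ℂ) * (dz k (toComplex r) z * f z)) (𝓝[>] 0)
      (𝓝 (∫ z in Ω, dz k f z)) := by
  have hr1 : ContDiff ℝ 1 r := hr.contDiff.of_le (by simp)
  have hfd : ∀ v, Integrable (fun z => fderiv ℝ f z v) (volume.restrict Ω) := fun v =>
    Continuous.integrable_restrict_of_isBounded hb ((hf.continuous_fderiv one_ne_zero).clm_apply continuous_const)
  have hg : ∀ δ v, Integrable (fun z => (shellDensity r δ z : ℂ) * (fderiv ℝ r z v * f z))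
      (volume.restrict Ω) := fun δ v => Continuous.integrable_restrict_of_isBounded hb
    ((Complex.continuous_ofReal.comp (hr.continuous_shellDensity δ)).mul
      ((Complex.continuous_ofReal.comp
        ((hr1.continuous_fderiv one_ne_zero).clm_apply continuous_const)).mul hf.continuous))
  have h := ((hr.tendsto_setIntegral_shellDensity hb hf (EuclideanSpace.single k 1)).sub
    ((hr.tendsto_setIntegral_shellDensity hb hf
      (EuclideanSpace.single k Complex.I)).const_mul Complex.I)).const_mul (1 / 2)
  simp_rw [← integral_const_mul] at h
  rw [← integral_sub (hfd _) ((hfd _).const_mul _), ← integral_const_mul] at h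
  refine h.congr fun δ => ?_
  rw [← integral_sub (hg δ _) ((hg δ _).const_mul _), ← integral_const_mul]
  refine integral_congr_ae (Eventually.of_forall fun z => ?_)
  simp only [dz, hr.fderiv_toComplex]
  ring

theorem tendsto_setIntegral_dzbar (hb : Bornology.IsBounded Ω) {f : Cn n → ℂ}
    (hf : ContDiff ℝ 1 f) (k : Fin n) :
    Tendsto (fun δ => ∫ z in Ω, (shellDensity r δ z : ℂ) * (dzbar k (toComplex r) z * f z))
      (𝓝[>] 0) (𝓝 (∫ z in Ω, dzbar k f z)) := by
  have hr1 : ContDiff ℝ 1 r := hr.contDiff.of_le (by simp)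
  have hfd : ∀ v, Integrable (fun z => fderiv ℝ f z v) (volume.restrict Ω) := fun v =>
    Continuous.integrable_restrict_of_isBounded hb ((hf.continuous_fderiv one_ne_zero).clm_apply continuous_const)
  have hg : ∀ δ v, Integrable (fun z => (shellDensity r δ z : ℂ) * (fderiv ℝ r z v * f z))
      (volume.restrict Ω) := fun δ v => Continuous.integrable_restrict_of_isBounded hb
    ((Complex.continuous_ofReal.comp (hr.continuous_shellDensity δ)).mul
      ((Complex.continuous_ofReal.comp
        ((hr1.continuous_fderiv one_ne_zero).clm_apply continuous_const)).mul hf.continuous))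
  have h := ((hr.tendsto_setIntegral_shellDensity hb hf (EuclideanSpace.single k 1)).add
    ((hr.tendsto_setIntegral_shellDensity hb hf
      (EuclideanSpace.single k Complex.I)).const_mul Complex.I)).const_mul (1 / 2)
  simp_rw [← integral_const_mul] at h
  rw [← integral_add (hfd _) ((hfd _).const_mul _), ← integral_const_mul] at h
  refine h.congr fun δ => ?_
  rw [← integral_add (hg δ _) ((hg δ _).const_mul _), ← integral_const_mul]
  refine integral_congr_ae (Eventually.of_forall fun z => ?_)
  simp only [dzbar, hr.fderiv_toComplex]
  ring

end IsGlobalDefiningFunction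

end Cutoff

/-! The boundary condition satisfied by the smooth forms in the domain of `∂̄*`. -/

section BoundaryCondition

open Filter Topology

variable {n : ℕ} {Ω : Set (Cn n)} {r : Cn n → ℝ}

theorem hasDerivAt_setIntegral_translate (hb : Bornology.IsBounded Ω) {η : Cn n → ℝ}
    (hη : ContDiff ℝ 1 η) (hc : HasCompactSupport η) (e : Cn n) (t : ℝ) :
    HasDerivAt (fun t : ℝ => ∫ x in Ω, η (x - t • e))
      (-∫ x in Ω, fderiv ℝ (fun y => η (y - t • e)) x e) t := by
  have hcont : Continuous fun x => fderiv ℝ η x e :=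
    (hη.continuous_fderiv one_ne_zero).clm_apply continuous_const
  obtain ⟨M, hM⟩ := (hc.fderiv_apply ℝ e).exists_bound_of_continuous hcont
  have hsub : ∀ t : ℝ, Continuous fun x : Cn n => x - t • e := fun t => by fun_prop
  have h := (hasDerivAt_integral_of_dominated_loc_of_deriv_le (μ := volume.restrict Ω)
    (F := fun (t : ℝ) x => η (x - t • e)) (F' := fun t x => -fderiv ℝ η (x - t • e) e)
    (bound := fun _ => M) (s := Set.univ) (x₀ := t) univ_mem ?_ ?_ ?_ ?_ ?_ ?_).2
  · refine (h.congr_deriv (integral_neg _)).congr_deriv (congrArg Neg.neg ?_)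
    refine integral_congr_ae (Eventually.of_forall fun x => ?_)
    beta_reduce
    rw [fderiv_comp_sub]
  · exact Eventually.of_forall fun t => (hη.continuous.comp (hsub t)).aestronglyMeasurable
  · exact Continuous.integrable_restrict_of_isBounded hb (hη.continuous.comp (hsub t))
  · exact (hcont.comp (hsub t)).neg.aestronglyMeasurable
  · exact Eventually.of_forall fun x s _ => by
      rw [norm_neg]
      exact hM _
  · exact Continuous.integrable_restrict_of_isBounded hb continuous_const
  · refine Eventually.of_forall fun x s _ => ?_
    have h1 : HasDerivAt (fun t : ℝ => x - t • e) (-e) s := by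
      simpa using ((hasDerivAt_id s).smul_const e).const_sub x
    have h2 := (hη.differentiable one_ne_zero (x - s • e)).hasFDerivAt.comp_hasDerivAt s h1
    exact h2.congr_deriv (by simp)

namespace IsGlobalDefiningFunction

variable (hr : IsGlobalDefiningFunction Ω r)

include hr

theorem exists_mem_and_notMem_closure {p : Cn n} (hp : p ∈ frontier Ω) {e : Cn n}
    (he : fderiv ℝ r p e = 1) : ∀ᶠ s : ℝ in 𝓝[>] 0, p - s • e ∈ Ω ∧ p + s • e ∉ closure Ω := by
  have hd : ∀ w : Cn n, HasDerivAt (fun t : ℝ => r (p + t • w)) (fderiv ℝ r p w) 0 := by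
    intro w
    have hline : HasDerivAt (fun t : ℝ => p + t • w) w 0 := by
      simpa using ((hasDerivAt_id (0 : ℝ)).smul_const w).const_add p
    refine HasFDerivAt.comp_hasDerivAt (0 : ℝ) (f := fun t : ℝ => p + t • w) (l := r) ?_ hline
    simpa using (hr.contDiff.differentiable (by simp) p).hasFDerivAt
  have h1 := (hd e).tendsto_slope_zero_right
  have h2 := (hd (-e)).tendsto_slope_zero_right
  simp only [zero_add, zero_smul, add_zero, hr.eq_zero hp, sub_zero, smul_eq_mul, map_neg, he,
    smul_neg, ← sub_eq_add_neg] at h1 h2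
  filter_upwards [h1.eventually_const_lt one_pos, h2.eventually_lt_const (by norm_num : (-1 : ℝ) < 0),
    self_mem_nhdsWithin] with s hs1 hs2 hs
  have hs : 0 < s := hs
  constructor
  · rw [hr.mem_iff]
    exact (pos_iff_neg_of_mul_neg hs2).1 (inv_pos.2 hs)
  · intro hcl
    exact absurd ((pos_iff_pos_of_mul_pos hs1).1 (inv_pos.2 hs))
      (not_lt.2 (hr.nonpos_of_mem_closure hcl))

/-- Push a small bump along `e` from inside `Ω` to outside its closure. If all these integrals
vanished, its integral over `Ω` would stay constant, yet it starts positive and ends at 0. -/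
theorem exists_setIntegral_fderiv_ne_zero (hb : Bornology.IsBounded Ω) {p : Cn n}
    (hp : p ∈ frontier Ω) {e : Cn n} (he : fderiv ℝ r p e = 1) {s₀ : ℝ} (hs₀ : 0 < s₀) :
    ∃ η : Cn n → ℝ, ContDiff ℝ ∞ η ∧ HasCompactSupport η ∧ tsupport η ⊆ Metric.ball p s₀ ∧
      ∫ x in Ω, fderiv ℝ η x e ≠ 0 := by
  by_contra! hcon
  have hsmall : ∀ᶠ s : ℝ in 𝓝[>] 0, s * ‖e‖ < s₀ / 2 := by
    have : Tendsto (fun s : ℝ => s * ‖e‖) (𝓝 0) (𝓝 (0 * ‖e‖)) :=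
      (continuous_id.mul continuous_const).tendsto 0
    rw [zero_mul] at this
    exact (this.mono_left nhdsWithin_le_nhds).eventually_lt_const (by positivity)
  obtain ⟨s, ⟨⟨hs1, hs2⟩, hs3⟩, hs⟩ := (((hr.exists_mem_and_notMem_closure hp he).and
    hsmall).and self_mem_nhdsWithin).exists
  have hs : 0 < s := hs
  obtain ⟨τ₁, hτ₁, hb₁⟩ := Metric.isOpen_iff.1 hr.isOpen _ hs1
  obtain ⟨τ₂, hτ₂, hb₂⟩ := Metric.isOpen_iff.1 isClosed_closure.isOpen_compl _ hs2
  obtain ⟨τ, hτ, hτ1, hτ2, hτ3⟩ : ∃ τ : ℝ, 0 < τ ∧ τ < τ₁ ∧ τ < τ₂ ∧ τ < s₀ / 2 := by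
    obtain ⟨τ, hτ, hτ'⟩ := exists_between (lt_min hτ₁ (lt_min hτ₂ (half_pos hs₀)))
    rw [lt_min_iff, lt_min_iff] at hτ'
    exact ⟨τ, hτ, hτ'.1, hτ'.2.1, hτ'.2.2⟩
  let η : ContDiffBump (p - s • e) := ⟨τ / 2, τ, half_pos hτ, half_lt_self hτ⟩
  have hη1 : ContDiff ℝ 1 η := η.contDiff
  have hderiv : ∀ t ∈ Set.Ico (0 : ℝ) (2 * s),
      HasDerivWithinAt (fun t : ℝ => ∫ x in Ω, η (x - t • e)) 0 (Set.Ici t) t := by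
    intro t ht
    have h := hasDerivAt_setIntegral_translate hb hη1 η.hasCompactSupport e t
    have hts : tsupport (fun y => η (y - t • e)) ⊆ Metric.closedBall (p - s • e + t • e) τ := by
      refine closure_minimal (fun y hy => ?_) Metric.isClosed_closedBall
      have hy2 : y - t • e ∈ Function.support η := hy
      rw [η.support_eq, Metric.mem_ball, dist_eq_norm] at hy2
      rw [Metric.mem_closedBall, dist_eq_norm]
      refine le_trans (le_of_eq ?_) hy2.le
      congr 1
      abel
    rw [hcon (fun y => η (y - t • e)) (η.contDiff.comp (contDiff_id.sub contDiff_const)),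
      neg_zero] at h
    · exact h.hasDerivWithinAt
    · exact (isCompact_closedBall _ _).of_isClosed_subset (isClosed_tsupport _) hts
    · refine hts.trans fun y hy => ?_
      rw [Metric.mem_closedBall, dist_eq_norm] at hy
      rw [Metric.mem_ball, dist_eq_norm]
      have h1 : ‖(t - s) • e‖ ≤ s * ‖e‖ := by
        rw [norm_smul, Real.norm_eq_abs]
        refine mul_le_mul_of_nonneg_right (abs_le.2 ⟨?_, ?_⟩) (norm_nonneg _) <;>
          linarith [ht.1, ht.2]
      calc ‖y - p‖ = ‖(y - (p - s • e + t • e)) + (t - s) • e‖ := by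
            congr 1
            rw [sub_smul]
            abel
        _ ≤ _ := norm_add_le _ _
        _ < s₀ := by linarith
  have hconst := constant_of_has_deriv_right_zero (a := (0 : ℝ)) (b := 2 * s)
    (fun t _ => (hasDerivAt_setIntegral_translate hb hη1 η.hasCompactSupport e
      t).continuousAt.continuousWithinAt) hderiv (2 * s) ⟨by linarith, le_rfl⟩
  have h0 : ∫ x in Ω, η (x - (2 * s) • e) = 0 := by
    refine (setIntegral_congr_fun hr.isOpen.measurableSet fun x hx => ?_).trans (integral_zero _ _)
    by_contra hne
    have hx2 : x - (2 * s) • e ∈ Function.support η := hne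
    rw [η.support_eq, Metric.mem_ball, dist_eq_norm] at hx2
    refine hb₂ (?_ : x ∈ Metric.ball (p + s • e) τ₂) (subset_closure hx)
    rw [Metric.mem_ball, dist_eq_norm]
    refine lt_of_le_of_lt (le_of_eq ?_) (hx2.trans hτ2)
    congr 1
    rw [mul_smul, two_smul]
    abel
  have h1 : 0 < ∫ x in Ω, η (x - (0 : ℝ) • e) := by
    simp only [zero_smul, sub_zero]
    rw [setIntegral_eq_integral_of_forall_compl_eq_zero]
    · exact η.integral_pos
    · intro x hx
      by_contra hne
      have hx2 : x ∈ Function.support η := hne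
      rw [η.support_eq] at hx2
      exact hx (hb₁ (Metric.ball_subset_ball hτ1.le hx2))
  linarith

/-- The hypothesis says that the boundary integral of `G ψ` vanishes, where `G = ∑ ∂r/∂z_k F_k`. If
`G p ≠ 0`, dividing by `G` near `p` lets `G ψ` be `dr(e) η` for any bump `η` there, so `∫ ∂_e η =
0`, contradicting the previous lemma. -/
theorem sum_dz_mul_eq_zero_of_setIntegral (hb : Bornology.IsBounded Ω) {F : Fin n → Cn n → ℂ}
    (hF : ∀ k, ContDiff ℝ ∞ (F k))
    (h : ∀ ψ : Cn n → ℂ, IsTestFunction Set.univ ψ →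
      ∫ z in Ω, ∑ k, dz k (fun w => F k w * ψ w) z = 0) {p : Cn n} (hp : p ∈ frontier Ω) :
    ∑ k, dz k (toComplex r) p * F k p = 0 := by
  by_contra hne
  have hrC : ContDiff ℝ ∞ (toComplex r) := Complex.ofRealCLM.contDiff.comp hr.contDiff
  have hdr : ∀ k, ContDiff ℝ ∞ (dz k (toComplex r)) := fun k => ContDiff.dz (by simpa using hrC) k
  have hG : ContDiff ℝ ∞ (fun z => ∑ k, dz k (toComplex r) z * F k z) :=
    ContDiff.sum fun k _ => (hdr k).mul (hF k)
  obtain ⟨e, he⟩ := hr.exists_fderiv_eq_one hp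
  obtain ⟨s₀, hs₀, hball⟩ := Metric.mem_nhds_iff.1 (hG.continuous.continuousAt.eventually_ne hne)
  obtain ⟨η, hη, hηc, hηs, hηne⟩ := hr.exists_setIntegral_fderiv_ne_zero hb hp he hs₀
  have hre : ContDiff ℝ ∞ fun z => (fderiv ℝ r z e : ℂ) :=
    Complex.ofRealCLM.contDiff.comp
      ((hr.contDiff.fderiv_right (m := ∞) (by simp)).clm_apply contDiff_const)
  have hηC : ContDiff ℝ ∞ fun z => (η z : ℂ) := Complex.ofRealCLM.contDiff.comp hη
  obtain ⟨ψ, hψ, hGψ⟩ : ∃ ψ : Cn n → ℂ, IsTestFunction Set.univ ψ ∧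
      ∀ z, (∑ k, dz k (toComplex r) z * F k z) * ψ z = fderiv ℝ r z e * η z := by
    refine ⟨fun z => (η z : ℂ) * ((fderiv ℝ r z e : ℂ) *
      (∑ k, dz k (toComplex r) z * F k z)⁻¹), ⟨contDiff_iff_contDiffAt.2 fun z => ?_,
      hηc.mono fun z hz h0 => hz (by simp [h0]), Set.subset_univ _⟩, fun z => ?_⟩
    · by_cases hz : z ∈ tsupport η
      · exact hηC.contDiffAt.mul (hre.contDiffAt.mul (hG.contDiffAt.inv (hball (hηs hz))))
      · refine (contDiffAt_const (c := (0 : ℂ))).congr_of_eventuallyEq ?_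
        filter_upwards [(isClosed_tsupport η).isOpen_compl.mem_nhds hz] with w hw
        rw [image_eq_zero_of_notMem_tsupport hw]
        simp
    · by_cases hz : z ∈ tsupport η
      · have hGz : ∑ k, dz k (toComplex r) z * F k z ≠ 0 := hball (hηs hz)
        field_simp
      · simp [image_eq_zero_of_notMem_tsupport hz]
  have hψ1 := hψ.contDiff.of_le (show (1 : WithTop ℕ∞) ≤ ∞ by simp)
  have hFψ : ∀ k, ContDiff ℝ 1 (fun w => F k w * ψ w) := fun k =>
    ((hF k).of_le (show (1 : WithTop ℕ∞) ≤ ∞ by simp)).mul hψ1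
  have hlim := tendsto_finsetSum Finset.univ fun k _ => hr.tendsto_setIntegral_dz hb (hFψ k) k
  have hw : ∀ δ, Continuous fun z => (shellDensity r δ z : ℂ) := fun δ =>
    Complex.continuous_ofReal.comp (hr.continuous_shellDensity δ)
  rw [← integral_finsetSum _ fun k _ => Continuous.integrable_restrict_of_isBounded hb
    (ContDiff.dz (m := 0) (by simpa using hFψ k) k).continuous, h _ hψ] at hlim
  have hlim2 := hr.tendsto_setIntegral_shellDensity hb
    (hηC.of_le (show (1 : WithTop ℕ∞) ≤ ∞ by simp)) e
  refine hηne ?_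
  have h3 := tendsto_nhds_unique_of_eventuallyEq hlim2 hlim (Eventually.of_forall fun δ => ?_)
  · have h4 : ∀ z, fderiv ℝ (fun z => (η z : ℂ)) z e = (fderiv ℝ η z e : ℂ) := fun z =>
      congrArg (fun L : Cn n →L[ℝ] ℂ => L e) (Complex.ofRealCLM.hasFDerivAt.comp z
        (hη.differentiable (by simp) z).hasFDerivAt).fderiv
    simp_rw [h4] at h3
    rw [integral_complex_ofReal] at h3
    exact_mod_cast h3
  · beta_reduce
    have hi : ∀ k, Integrable (fun z => (shellDensity r δ z : ℂ) *
        (dz k (toComplex r) z * (F k z * ψ z))) (volume.restrict Ω) := fun k =>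
      Continuous.integrable_restrict_of_isBounded hb
        ((hw δ).mul ((hdr k).continuous.mul (hFψ k).continuous))
    rw [← integral_finsetSum _ fun k _ => hi k]
    refine integral_congr_ae (Eventually.of_forall fun z => ?_)
    beta_reduce
    rw [← hGψ, Finset.sum_mul, Finset.mul_sum]
    simp_rw [mul_assoc]

/-- Smooth forms in the domain of `∂̄*` are complex tangential on the boundary. -/
theorem sum_dz_mul_contractOp_eq_zero (hb : Bornology.IsBounded Ω) {u : Cn n → FormVal n}
    (hu : ContDiff ℝ ∞ u) {U : (dbarStar Ω).domain} (hU : Represents Ω u U)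
    (K : Finset (Fin n)) {p : Cn n} (hp : p ∈ frontier Ω) :
    ∑ k, dz k (toComplex r) p * contractOp k (u p) K = 0 :=
  hr.sum_dz_mul_eq_zero_of_setIntegral hb (F := fun k z => contractOp k (u z) K)
    (fun k => contDiff_contractOp hu k K)
    (fun _ hψ => setIntegral_sum_dz_mul_eq_zero hr.isOpen (hu.of_le (by simp)) hU hψ K) hp

end IsGlobalDefiningFunction

end BoundaryCondition

/-! The Kohn–Morrey inequality. -/

section KohnMorrey

open Filter Topology

variable {n : ℕ} {Ω : Set (Cn n)} {r : Cn n → ℝ}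

theorem Filter.EventuallyEq.dzbar_eq {f g : Cn n → ℂ} {z : Cn n} (h : f =ᶠ[𝓝 z] g) (k : Fin n) :
    dzbar k f z = dzbar k g z := by
  rw [dzbar, dzbar, h.fderiv_eq]

theorem Filter.EventuallyEq.dz_eq {f g : Cn n → ℂ} {z : Cn n} (h : f =ᶠ[𝓝 z] g) (k : Fin n) :
    dz k f z = dz k g z := by
  rw [dz, dz, h.fderiv_eq]

theorem Filter.EventuallyEq.toComplex {f g : Cn n → ℝ} {z : Cn n} (h : f =ᶠ[𝓝 z] g) :
    toComplex f =ᶠ[𝓝 z] toComplex g :=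
  h.fun_comp Complex.ofReal

theorem Filter.EventuallyEq.complexHessian_eq {f g : Cn n → ℝ} {z : Cn n} (h : f =ᶠ[𝓝 z] g)
    (j k : Fin n) : complexHessian f j k z = complexHessian g j k z := by
  refine Filter.EventuallyEq.dz_eq ?_ j
  filter_upwards [h.toComplex.eventuallyEq_nhds] with w hw
  exact hw.dzbar_eq k

theorem IsLeviPseudoconvex.congr {ρ : Cn n → ℝ} (h : IsLeviPseudoconvex Ω ρ)
    (hr : ∀ z ∈ closure Ω, r =ᶠ[𝓝 z] ρ) : IsLeviPseudoconvex Ω r := by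
  intro z hz w hw
  have hz' := hr z (frontier_subset_closure hz)
  simp_rw [hz'.complexHessian_eq]
  refine h z hz w ?_
  simp_rw [← hz'.toComplex.dz_eq]
  exact hw

/-- The two second-order terms agree because mixed derivatives commute, so the divergence is
quadratic in first derivatives. -/
theorem dz_mul_conj_dz_sub {a b : Cn n → ℂ} (ha : ContDiff ℝ ∞ a) (hb : ContDiff ℝ ∞ b)
    (j k : Fin n) (z : Cn n) :
    dz j (fun w => a w * conj (dz k b w)) z - dzbar k (fun w => a w * conj (dzbar j b w)) z =
      dz j a z * conj (dz k b z) - dzbar k a z * conj (dzbar j b z) := by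
  have hbc : ContDiff ℝ ∞ (fun z => conj (b z)) := Complex.conjCLE.contDiff.comp hb
  have e1 : (fun w => conj (dz k b w)) = dzbar k fun w => conj (b w) := by
    ext w
    rw [dzbar_conj k (hb.differentiable (by simp) w)]
  have e2 : (fun w => conj (dzbar j b w)) = dz j fun w => conj (b w) := by
    ext w
    rw [dz_conj j (hb.differentiable (by simp) w)]
  have h1 : ContDiff ℝ ∞ (dzbar k fun w => conj (b w)) := ContDiff.dzbar (by simpa using hbc) k
  have h2 : ContDiff ℝ ∞ (dz j fun w => conj (b w)) := ContDiff.dz (by simpa using hbc) j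
  have h3 := dz_dzbar_comm (z := z)
    (hbc.of_le (show (2 : WithTop ℕ∞) ≤ ∞ from WithTop.coe_le_coe.2 le_top)) j k
  have e1z := congrFun e1 z
  have e2z := congrFun e2 z
  beta_reduce at e1z e2z
  rw [← e1] at h1
  rw [← e2] at h2
  rw [dz_mul j (ha.differentiable (by simp) z) (h1.differentiable (by simp) z),
    dzbar_mul k (ha.differentiable (by simp) z) (h2.differentiable (by simp) z), e1, e2, h3]
  ring

theorem integral_sum_sum_sub {α ι : Type*} [Fintype ι] {m : MeasurableSpace α} {μ : Measure α}
    {f g : ι → ι → α → ℂ} (hf : ∀ j k, Integrable (f j k) μ) (hg : ∀ j k, Integrable (g j k) μ) :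
    ∫ z, ∑ j, ∑ k, (f j k z - g j k z) ∂μ = ∑ j, ∑ k, (∫ z, f j k z ∂μ - ∫ z, g j k z ∂μ) := by
  have h : ∀ j k, Integrable (fun z => f j k z - g j k z) μ := fun j k => (hf j k).sub (hg j k)
  rw [integral_finsetSum _ fun j _ => integrable_finsetSum _ fun k _ => h j k]
  refine Finset.sum_congr rfl fun j _ => ?_
  rw [integral_finsetSum _ fun k _ => h j k]
  exact Finset.sum_congr rfl fun k _ => integral_sub (hf j k) (hg j k)

namespace IsGlobalDefiningFunction

variable (hr : IsGlobalDefiningFunction Ω r)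

include hr

theorem contDiff_toComplex : ContDiff ℝ ∞ (toComplex r) :=
  Complex.ofRealCLM.contDiff.comp hr.contDiff

theorem dzbar_toComplex (k : Fin n) (z : Cn n) :
    dzbar k (toComplex r) z = conj (dz k (toComplex r) z) := by
  rw [← dzbar_conj k (hr.contDiff_toComplex.differentiable (by simp) z)]
  congr 1
  ext w
  simp [toComplex]

/-- The boundary integrand in the Kohn–Morrey identity is nonnegative. -/
theorem re_boundary_nonneg (hb : Bornology.IsBounded Ω) (hL : IsLeviPseudoconvex Ω r)
    {a : Fin n → Cn n → ℂ} (ha : ∀ j, ContDiff ℝ ∞ (a j))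
    (ha0 : ∀ z ∈ frontier Ω, ∑ j, dz j (toComplex r) z * a j z = 0) {p : Cn n}
    (hp : p ∈ frontier Ω) :
    0 ≤ (∑ j, ∑ k, (dz j (toComplex r) p * (a j p * conj (dz k (a k) p)) -
      dzbar k (toComplex r) p * (a j p * conj (dzbar j (a k) p)))).re := by
  have hrC := hr.contDiff_toComplex
  have hdr : ∀ k, ContDiff ℝ ∞ (dzbar k (toComplex r)) := fun k =>
    ContDiff.dzbar (by simpa using hrC) k
  have hac : ∀ k, ContDiff ℝ ∞ (fun z => conj (a k z)) := fun k =>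
    Complex.conjCLE.contDiff.comp (ha k)
  have hd : ∀ k, DifferentiableAt ℝ (fun w => dzbar k (toComplex r) w * conj (a k w)) p :=
    fun k => ((hdr k).mul (hac k)).differentiable (by simp) p
  -- The conjugated tangential condition vanishes along the boundary, so its differential is a
  -- multiple of `dr`; by tangentiality, `∑ a_j ∂/∂z_j` kills it at `p`.
  obtain ⟨c, hc⟩ := hr.exists_fderiv_eq_mul hb
    (G := fun z => ∑ k, dzbar k (toComplex r) z * conj (a k z))
    (ContDiff.sum fun k _ => ((hdr k).mul (hac k)).of_le (by simp)) (fun z hz => by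
      have h := congrArg (starRingEnd ℂ) (ha0 z hz)
      rw [map_zero, map_sum] at h
      rw [← h]
      refine Finset.sum_congr rfl fun k _ => ?_
      rw [map_mul, hr.dzbar_toComplex]) hp
  have h1 : ∀ j, dz j (fun z => ∑ k, dzbar k (toComplex r) z * conj (a k z)) p =
      c * dz j (toComplex r) p := by
    intro j
    rw [dz, hc, hc, dz, hr.fderiv_toComplex, hr.fderiv_toComplex]
    ring
  have h2 : ∑ j, a j p * dz j (fun z => ∑ k, dzbar k (toComplex r) z * conj (a k z)) p = 0 := by
    calc _ = c * ∑ j, dz j (toComplex r) p * a j p := by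
          rw [Finset.mul_sum]
          refine Finset.sum_congr rfl fun j _ => ?_
          rw [h1]
          ring
      _ = 0 := by rw [ha0 p hp, mul_zero]
  have h3 : ∀ j, dz j (fun z => ∑ k, dzbar k (toComplex r) z * conj (a k z)) p =
      ∑ k, (complexHessian r j k p * conj (a k p) +
        dzbar k (toComplex r) p * conj (dzbar j (a k) p)) := by
    intro j
    rw [dz_sum _ _ fun k _ => hd k]
    refine Finset.sum_congr rfl fun k _ => ?_
    rw [dz_mul j ((hdr k).differentiable (by simp) p) ((hac k).differentiable (by simp) p),
      dz_conj j ((ha k).differentiable (by simp) p)]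
    rfl
  -- The first sum has the factor `∑ ∂r/∂z_j a_j = 0`; `h2`, expanded by the product rule, turns the
  -- second into the Levi form.
  have h4 : ∑ j, ∑ k, (dz j (toComplex r) p * (a j p * conj (dz k (a k) p)) -
      dzbar k (toComplex r) p * (a j p * conj (dzbar j (a k) p))) =
      ∑ j, ∑ k, complexHessian r j k p * a j p * conj (a k p) := by
    have h5 : ∑ j, ∑ k, dz j (toComplex r) p * (a j p * conj (dz k (a k) p)) = 0 := by
      calc _ = (∑ j, dz j (toComplex r) p * a j p) * ∑ k, conj (dz k (a k) p) := by
            rw [Finset.sum_mul_sum]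
            simp_rw [mul_assoc]
        _ = 0 := by rw [ha0 p hp, zero_mul]
    simp_rw [Finset.sum_sub_distrib]
    rw [h5, zero_sub, neg_eq_iff_add_eq_zero, ← h2, ← Finset.sum_add_distrib]
    refine Finset.sum_congr rfl fun j _ => ?_
    rw [h3, Finset.mul_sum, ← Finset.sum_add_distrib]
    refine Finset.sum_congr rfl fun k _ => ?_
    ring
  rw [h4]
  exact hL p hp (fun j => a j p) (ha0 p hp)

/-- The Kohn–Morrey inequality for a vector field that is complex tangential on the boundary. -/
theorem re_setIntegral_nonneg (hb : Bornology.IsBounded Ω) (hL : IsLeviPseudoconvex Ω r)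
    {a : Fin n → Cn n → ℂ} (ha : ∀ j, ContDiff ℝ ∞ (a j))
    (ha0 : ∀ z ∈ frontier Ω, ∑ j, dz j (toComplex r) z * a j z = 0) :
    0 ≤ ∫ z in Ω, (∑ j, ∑ k, (dz j (a j) z * conj (dz k (a k) z) -
      dzbar k (a j) z * conj (dzbar j (a k) z))).re := by
  have hrC := hr.contDiff_toComplex
  have hz : ∀ f : Cn n → ℂ, ContDiff ℝ ∞ f → ∀ k, ContDiff ℝ ∞ (dz k f) := fun f hf k =>
    ContDiff.dz (by simpa using hf) k
  have hzb : ∀ f : Cn n → ℂ, ContDiff ℝ ∞ f → ∀ k, ContDiff ℝ ∞ (dzbar k f) := fun f hf k =>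
    ContDiff.dzbar (by simpa using hf) k
  have hcj : ∀ f : Cn n → ℂ, ContDiff ℝ ∞ f → ContDiff ℝ ∞ (fun z => conj (f z)) := fun f hf =>
    Complex.conjCLE.contDiff.comp hf
  have h1 : ∀ j k, ContDiff ℝ ∞ fun z => a j z * conj (dz k (a k) z) := fun j k =>
    (ha j).mul (hcj _ (hz _ (ha k) k))
  have h2 : ∀ j k, ContDiff ℝ ∞ fun z => a j z * conj (dzbar j (a k) z) := fun j k =>
    (ha j).mul (hcj _ (hzb _ (ha k) j))
  have hint : ∀ {f : Cn n → ℂ}, ContDiff ℝ ∞ f → Integrable f (volume.restrict Ω) := fun hf =>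
    Continuous.integrable_restrict_of_isBounded hb hf.continuous
  have hw : ∀ δ, Continuous fun z => (shellDensity r δ z : ℂ) := fun δ =>
    Complex.continuous_ofReal.comp (hr.continuous_shellDensity δ)
  have hlim : Tendsto (fun δ => ∑ j, ∑ k,
      ((∫ z in Ω, (shellDensity r δ z : ℂ) * (dz j (toComplex r) z * (a j z * conj (dz k (a k) z)))) -
      ∫ z in Ω, (shellDensity r δ z : ℂ) *
        (dzbar k (toComplex r) z * (a j z * conj (dzbar j (a k) z))))) (𝓝[>] 0)
      (𝓝 (∑ j, ∑ k, ((∫ z in Ω, dz j (fun w => a j w * conj (dz k (a k) w)) z) -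
        ∫ z in Ω, dzbar k (fun w => a j w * conj (dzbar j (a k) w)) z))) :=
    tendsto_finsetSum _ fun j _ => tendsto_finsetSum _ fun k _ =>
      (hr.tendsto_setIntegral_dz hb ((h1 j k).of_le (by simp)) j).sub
      (hr.tendsto_setIntegral_dzbar hb ((h2 j k).of_le (by simp)) k)
  have hΘ : ContDiff ℝ ∞ fun z => ∑ j, ∑ k,
      (dz j (toComplex r) z * (a j z * conj (dz k (a k) z)) -
      dzbar k (toComplex r) z * (a j z * conj (dzbar j (a k) z))) :=
    ContDiff.sum fun j _ => ContDiff.sum fun k _ =>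
      ((hz _ hrC j).mul (h1 j k)).sub ((hzb _ hrC k).mul (h2 j k))
  have hR : ContDiff ℝ ∞ fun z => ∑ j, ∑ k, (dz j (a j) z * conj (dz k (a k) z) -
      dzbar k (a j) z * conj (dzbar j (a k) z)) :=
    ContDiff.sum fun j _ => ContDiff.sum fun k _ =>
      ((hz _ (ha j) j).mul (hcj _ (hz _ (ha k) k))).sub
        ((hzb _ (ha j) k).mul (hcj _ (hzb _ (ha k) j)))
  have e1 : ∀ δ, ∑ j, ∑ k,
      ((∫ z in Ω, (shellDensity r δ z : ℂ) * (dz j (toComplex r) z * (a j z * conj (dz k (a k) z)))) -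
      ∫ z in Ω, (shellDensity r δ z : ℂ) *
        (dzbar k (toComplex r) z * (a j z * conj (dzbar j (a k) z)))) =
      ∫ z in Ω, (shellDensity r δ z : ℂ) * ∑ j, ∑ k,
        (dz j (toComplex r) z * (a j z * conj (dz k (a k) z)) -
        dzbar k (toComplex r) z * (a j z * conj (dzbar j (a k) z))) := by
    intro δ
    have i1 : ∀ j k, Integrable (fun z => (shellDensity r δ z : ℂ) *
        (dz j (toComplex r) z * (a j z * conj (dz k (a k) z)))) (volume.restrict Ω) := fun j k =>
      Continuous.integrable_restrict_of_isBounded hb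
        ((hw δ).mul ((hz _ hrC j).mul (h1 j k)).continuous)
    have i2 : ∀ j k, Integrable (fun z => (shellDensity r δ z : ℂ) *
        (dzbar k (toComplex r) z * (a j z * conj (dzbar j (a k) z)))) (volume.restrict Ω) :=
      fun j k => Continuous.integrable_restrict_of_isBounded hb
        ((hw δ).mul ((hzb _ hrC k).mul (h2 j k)).continuous)
    simp_rw [Finset.mul_sum, mul_sub]
    exact (integral_sum_sum_sub i1 i2).symm
  have e2 : ∑ j, ∑ k, ((∫ z in Ω, dz j (fun w => a j w * conj (dz k (a k) w)) z) -
        ∫ z in Ω, dzbar k (fun w => a j w * conj (dzbar j (a k) w)) z) =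
      ∫ z in Ω, ∑ j, ∑ k, (dz j (a j) z * conj (dz k (a k) z) -
        dzbar k (a j) z * conj (dzbar j (a k) z)) := by
    have i1 := fun j k => hint (hz _ (h1 j k) j)
    have i2 := fun j k => hint (hzb _ (h2 j k) k)
    simp_rw [← dz_mul_conj_dz_sub (ha _) (ha _)]
    exact (integral_sum_sum_sub i1 i2).symm
  simp_rw [e1] at hlim
  rw [e2] at hlim
  have hre := (Complex.continuous_re.tendsto _).comp hlim
  have e3 : ∀ {f : Cn n → ℂ}, Integrable f (volume.restrict Ω) →
      (∫ z in Ω, f z).re = ∫ z in Ω, (f z).re := fun hf => (integral_re hf).symm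
  rw [e3 (hint hR)] at hre
  refine hr.nonneg_of_tendsto_shellDensity hb
    ((Complex.reCLM.contDiff.comp hΘ).of_le (by simp))
    (fun p hp => hr.re_boundary_nonneg hb hL ha ha0 hp) (hre.congr fun δ => ?_)
  refine (e3 (Continuous.integrable_restrict_of_isBounded hb
    ((hw δ).mul hΘ.continuous))).trans ?_
  refine integral_congr_ae (Eventually.of_forall fun z => ?_)
  exact Complex.re_ofReal_mul _ _

end IsGlobalDefiningFunction

/-- The derivative `∂u/∂z̄_k`, coefficient by coefficient. -/
noncomputable def dzbarForm (k : Fin n) (u : Cn n → FormVal n) (z : Cn n) : FormVal n :=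
  WithLp.toLp 2 fun I => dzbar k (fun w => u w I) z

theorem contDiff_coeff {m : WithTop ℕ∞} {u : Cn n → FormVal n} (hu : ContDiff ℝ m u)
    (I : Finset (Fin n)) : ContDiff ℝ m (fun z => u z I) :=
  ((EuclideanSpace.proj I : FormVal n →L[ℂ] ℂ).restrictScalars ℝ).contDiff.comp hu

theorem dzbar_contractOp {u : Cn n → FormVal n} (hu : ContDiff ℝ 1 u) (j k : Fin n)
    (K : Finset (Fin n)) (z : Cn n) :
    dzbar j (fun w => contractOp k (u w) K) z = contractOp k (dzbarForm j u z) K := by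
  simp only [contractOp_apply, dzbarForm]
  split_ifs
  · simp [dzbar]
  · rw [dzbar_const_mul j _ ((contDiff_coeff hu _).differentiable one_ne_zero z)]

theorem continuous_dzbarForm {u : Cn n → FormVal n} (hu : ContDiff ℝ 1 u) (k : Fin n) :
    Continuous (dzbarForm k u) :=
  (PiLp.continuous_toLp 2 _).comp (continuous_pi fun I =>
    (ContDiff.dzbar (m := 0) (by simpa using contDiff_coeff hu I) k).continuous)

theorem L2Forms.norm_sq_eq_integral (f : L2Forms Ω) : ‖f‖ ^ 2 = ∫ z in Ω, ‖f z‖ ^ 2 := by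
  have h : (‖f‖ ^ 2 : ℝ) = (⟪f, f⟫_ℂ).re := (inner_self_eq_norm_sq (𝕜 := ℂ) f).symm
  have h2 : (∫ z in Ω, ⟪f z, f z⟫_ℂ).re = ∫ z in Ω, (⟪f z, f z⟫_ℂ).re :=
    (integral_re (L2.integrable_inner (𝕜 := ℂ) f f)).symm
  rw [h, L2.inner_def, h2]
  refine integral_congr_ae (Eventually.of_forall fun z => ?_)
  exact inner_self_eq_norm_sq (𝕜 := ℂ) (f z)

/-- The Kohn–Morrey inequality. -/
theorem IsGlobalDefiningFunction.sum_integral_dzbarForm_le (hr : IsGlobalDefiningFunction Ω r)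
    (hb : Bornology.IsBounded Ω) (hL : IsLeviPseudoconvex Ω r) {u : Cn n → FormVal n}
    (hu : ContDiff ℝ ∞ u) {U : (dbarStar Ω).domain} (hU : Represents Ω u U) :
    ∑ k, ∫ z in Ω, ‖dzbarForm k u z‖ ^ 2 ≤
      l2NormSq Ω (smoothDbar u) + ‖dbarStar Ω U‖ ^ 2 := by
  have hu1 : ContDiff ℝ 1 u := hu.of_le (by simp)
  have ha : ∀ K j, ContDiff ℝ ∞ fun z => contractOp j (u z) K := fun K j =>
    contDiff_contractOp hu j K
  have hdz : ∀ K j, Continuous (dz j fun z => contractOp j (u z) K) := fun K j =>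
    (ContDiff.dz (m := 0) (by simpa using (ha K j).of_le (by simp)) j).continuous
  have hd : ∀ k, Continuous (dzbarForm k u) := continuous_dzbarForm hu1
  -- One vector field `(u_{jK})_j` for each `K`.
  have hK := fun K : Finset (Fin n) => hr.re_setIntegral_nonneg hb hL (ha K)
    (fun z hz => hr.sum_dz_mul_contractOp_eq_zero hb hu hU K hz)
  -- Summed over `K`, the divergence products give `|∂̄*u|²`, while the mixed products are handled
  -- by `norm_sum_wedgeOp_sq`.
  have hpt : ∀ z, ∑ K : Finset (Fin n), (∑ j, ∑ k, (dz j (fun w => contractOp j (u w) K) z *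
        conj (dz k (fun w => contractOp k (u w) K) z) -
      dzbar k (fun w => contractOp j (u w) K) z *
        conj (dzbar j (fun w => contractOp k (u w) K) z))).re =
      ∑ K : Finset (Fin n), ‖∑ j, dz j (fun w => contractOp j (u w) K) z‖ ^ 2 +
        ‖smoothDbar u z‖ ^ 2 - ∑ k, ‖dzbarForm k u z‖ ^ 2 := by
    intro z
    have h1 := norm_sum_wedgeOp_sq fun k => dzbarForm k u z
    rw [show ∑ k, wedgeOp k (dzbarForm k u z) = smoothDbar u z from
      (smoothDbar_eq_sum u z).symm] at h1
    have h2 : ∑ K : Finset (Fin n), (∑ j, ∑ k, dzbar k (fun w => contractOp j (u w) K) z *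
        conj (dzbar j (fun w => contractOp k (u w) K) z)) =
        ∑ j, ∑ k, ⟪contractOp k (dzbarForm j u z), contractOp j (dzbarForm k u z)⟫_ℂ := by
      rw [Finset.sum_comm]
      refine Finset.sum_congr rfl fun j _ => ?_
      rw [Finset.sum_comm]
      refine Finset.sum_congr rfl fun k _ => ?_
      rw [PiLp.inner_apply]
      simp only [RCLike.inner_apply, dzbar_contractOp hu1]
    have h3 : ∀ K : Finset (Fin n), (∑ j, ∑ k, dz j (fun w => contractOp j (u w) K) z *
        conj (dz k (fun w => contractOp k (u w) K) z)).re =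
        ‖∑ j, dz j (fun w => contractOp j (u w) K) z‖ ^ 2 := by
      intro K
      rw [← Finset.sum_mul_sum, ← map_sum, Complex.mul_conj, Complex.ofReal_re,
        Complex.normSq_eq_norm_sq]
    simp_rw [Finset.sum_sub_distrib, Complex.sub_re, Finset.sum_sub_distrib, h3]
    rw [h1, ← h2, Complex.re_sum]
    ring
  have hstar : ‖dbarStar Ω U‖ ^ 2 =
      ∫ z in Ω, ∑ K : Finset (Fin n), ‖∑ j, dz j (fun w => contractOp j (u w) K) z‖ ^ 2 := by
    rw [L2Forms.norm_sq_eq_integral]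
    refine integral_congr_ae ?_
    filter_upwards [ae_all_iff.2 fun K => dbarStar_ae_eq hr.isOpen hu1 hU K] with z hz
    rw [EuclideanSpace.norm_sq_eq]
    refine Finset.sum_congr rfl fun K _ => ?_
    rw [hz K, norm_neg]
  have hsd : Continuous (smoothDbar u) := by
    have : smoothDbar u = fun z => ∑ k, wedgeOp k (dzbarForm k u z) :=
      funext fun z => smoothDbar_eq_sum u z
    rw [this]
    exact continuous_finsetSum _ fun k _ => (wedgeOp k).continuous.comp (hd k)
  have i1 : Integrable (fun z => ∑ K : Finset (Fin n),
      ‖∑ j, dz j (fun w => contractOp j (u w) K) z‖ ^ 2) (volume.restrict Ω) :=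
    Continuous.integrable_restrict_of_isBounded hb (continuous_finsetSum _ fun K _ =>
      (continuous_finsetSum _ fun j _ => hdz K j).norm.pow 2)
  have i2 : Integrable (fun z => ‖smoothDbar u z‖ ^ 2) (volume.restrict Ω) :=
    Continuous.integrable_restrict_of_isBounded hb (hsd.norm.pow 2)
  have i3 : ∀ k, Integrable (fun z => ‖dzbarForm k u z‖ ^ 2) (volume.restrict Ω) := fun k =>
    Continuous.integrable_restrict_of_isBounded hb ((hd k).norm.pow 2)
  have i4 : ∀ K : Finset (Fin n), Integrable (fun z => (∑ j, ∑ k,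
      (dz j (fun w => contractOp j (u w) K) z * conj (dz k (fun w => contractOp k (u w) K) z) -
      dzbar k (fun w => contractOp j (u w) K) z *
        conj (dzbar j (fun w => contractOp k (u w) K) z))).re) (volume.restrict Ω) := by
    intro K
    have hdb : ∀ j k, Continuous (dzbar j fun z => contractOp k (u z) K) := fun j k =>
      (ContDiff.dzbar (m := 0) (by simpa using (ha K k).of_le (by simp)) j).continuous
    refine Continuous.integrable_restrict_of_isBounded hb (Complex.continuous_re.comp
      (continuous_finsetSum _ fun j _ => continuous_finsetSum _ fun k _ => ?_))
    exact ((hdz K j).mul (Complex.continuous_conj.comp (hdz K k))).sub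
      ((hdb k j).mul (Complex.continuous_conj.comp (hdb j k)))
  have h0 := Finset.sum_nonneg fun K (_ : K ∈ Finset.univ) => hK K
  rw [← integral_finsetSum _ fun K _ => i4 K] at h0
  simp_rw [hpt] at h0
  have i5 : Integrable (fun z => ∑ K : Finset (Fin n),
      ‖∑ j, dz j (fun w => contractOp j (u w) K) z‖ ^ 2 + ‖smoothDbar u z‖ ^ 2)
      (volume.restrict Ω) := i1.add i2
  rw [integral_sub i5 (integrable_finsetSum _ fun k _ => i3 k), integral_add i1 i2,
    integral_finsetSum _ fun k _ => i3 k, ← hstar] at h0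
  rw [l2NormSq]
  linarith

theorem smoothDbar_contraction {u : Cn n → FormVal n} (hu : ContDiff ℝ 1 u) (k : Fin n)
    (z : Cn n) :
    smoothDbar (contraction k u) z = ∑ j, wedgeOp j (contractOp k (dzbarForm j u z)) := by
  rw [smoothDbar_eq_sum]
  refine Finset.sum_congr rfl fun j _ => ?_
  congr 1
  ext K
  exact dzbar_contractOp hu j k K z

/-- Wedge and contraction are pointwise contractive; the factor `n` is Cauchy–Schwarz over the `n`
summands. -/
theorem l2NormSq_smoothDbar_contraction_le (hb : Bornology.IsBounded Ω) {u : Cn n → FormVal n}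
    (hu : ContDiff ℝ 1 u) (k : Fin n) :
    l2NormSq Ω (smoothDbar (contraction k u)) ≤ n * ∑ j, ∫ z in Ω, ‖dzbarForm j u z‖ ^ 2 := by
  have hd := continuous_dzbarForm hu
  have i3 : ∀ k, Integrable (fun z => ‖dzbarForm k u z‖ ^ 2) (volume.restrict Ω) := fun k =>
    Continuous.integrable_restrict_of_isBounded hb ((hd k).norm.pow 2)
  rw [← integral_finsetSum _ fun j _ => i3 j, ← integral_const_mul, l2NormSq]
  refine integral_mono ?_ ((integrable_finsetSum _ fun j _ => i3 j).const_mul _) fun z => ?_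
  · simp_rw [smoothDbar_contraction hu]
    exact Continuous.integrable_restrict_of_isBounded hb ((continuous_finsetSum _ fun j _ =>
      (wedgeOp j).continuous.comp ((contractOp k).continuous.comp (hd j))).norm.pow 2)
  · beta_reduce
    rw [smoothDbar_contraction hu]
    have h1 : ‖∑ j, wedgeOp j (contractOp k (dzbarForm j u z))‖ ≤ ∑ j, ‖dzbarForm j u z‖ :=
      (norm_sum_le _ _).trans (Finset.sum_le_sum fun j _ =>
        (norm_wedgeOp_le j _).trans (norm_contractOp_le k _))
    have h2 := sq_sum_le_card_mul_sum_sq (s := Finset.univ) (f := fun j => ‖dzbarForm j u z‖)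
    rw [Finset.card_univ, Fintype.card_fin] at h2
    exact (pow_le_pow_left₀ (norm_nonneg _) h1 2).trans h2

end KohnMorrey

/-! Contractions of forms and the two conditions. -/

section Contraction

open Filter Topology

variable {n : ℕ} {Ω : Set (Cn n)}

theorem IsSmoothForm.contraction {q : ℕ} {u : Cn n → FormVal n} (hu : IsSmoothForm (q + 1) u)
    (k : Fin n) : IsSmoothForm q (contraction k u) := by
  refine ⟨((contractOp k).restrictScalars ℝ).contDiff.comp hu.contDiff, fun z I hI => ?_⟩
  change coeffCons (u z) k I = 0
  rw [coeffCons]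
  split_ifs with h
  · rfl
  · rw [hu.degree z _ (by rw [Finset.card_insert_of_notMem h]; omega), mul_zero]

/-- The contractions `v_k` of a smooth form `u` in the domain of `∂̄*` lie in the domain of `∂̄*`,
and `∂̄v_k` and `∂̄*v_k` are controlled by `∂̄u` and `∂̄*u`. -/
theorem IsSmoothBoundedPseudoconvexDomain.exists_contraction_bound
    (hΩ : IsSmoothBoundedPseudoconvexDomain Ω) (q : ℕ) :
    ∃ B : ℝ, ∀ (u : Cn n → FormVal n) (U : (dbarStar Ω).domain),
      IsSmoothForm (q + 1) u → Represents Ω u U → ∀ k : Fin n,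
        IsSmoothForm q (contraction k u) ∧
        ∃ V : (dbarStar Ω).domain, Represents Ω (contraction k u) V ∧
          ‖dbarStar Ω V‖ ≤ ‖dbarStar Ω U‖ ∧
          l2NormSq Ω (smoothDbar (contraction k u)) ≤
            B * (l2NormSq Ω (smoothDbar u) + ‖dbarStar Ω U‖ ^ 2) := by
  obtain ⟨r₀, hr₀, hL₀⟩ := hΩ.pseudoconvex
  obtain ⟨r, hr, hrr⟩ := hr₀.exists_global
  have hL : IsLeviPseudoconvex Ω r := hL₀.congr hrr
  refine ⟨n, fun u U hu hU k => ⟨hu.contraction k, ?_⟩⟩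
  obtain ⟨V, hV, hVU⟩ := exists_dbarStar_contractOp hΩ.isOpen U k
  refine ⟨V, ?_, hVU, ?_⟩
  · rw [hV]
    exact hU.contractOp k
  · exact (l2NormSq_smoothDbar_contraction_le hΩ.isBounded (hu.contDiff.of_le (by simp)) k).trans
      (mul_le_mul_of_nonneg_left
        (hr.sum_integral_dzbarForm_le hΩ.isBounded hL hu.contDiff hU) n.cast_nonneg)

theorem negOneNormFun_zero : negOneNormFun Ω (fun _ => 0) = 0 := by
  refine le_antisymm (Real.sSup_nonpos ?_) (Real.sSup_nonneg ?_) <;>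
  · rintro t ⟨φ, -, -, rfl⟩
    simp

theorem negOneNormFun_const_mul {c : ℂ} (hc : ‖c‖ = 1) (f : Cn n → ℂ) :
    negOneNormFun Ω (fun z => c * f z) = negOneNormFun Ω f := by
  simp only [negOneNormFun, mul_assoc, integral_const_mul, norm_mul, hc, one_mul]

theorem negOneNormSq_nonneg (u : Cn n → FormVal n) : 0 ≤ negOneNormSq Ω u :=
  Finset.sum_nonneg fun _ _ => sq_nonneg _

/-- Up to sign, the nontrivial coefficients of `v_k` are the `u_J` with `k ∈ J`, each occurring
once. -/
theorem negOneNormSq_contraction_le (u : Cn n → FormVal n) (k : Fin n) :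
    negOneNormSq Ω (contraction k u) ≤ negOneNormSq Ω u := by
  have h1 : ∀ K : Finset (Fin n), negOneNormFun Ω (fun z => contraction k u z K) ^ 2 =
      if k ∈ K then 0 else negOneNormFun Ω (fun z => u z (insert k K)) ^ 2 := by
    intro K
    have h2 : (fun z => contraction k u z K) =
        fun z => if k ∈ K then 0 else wedgeSign k K * u z (insert k K) := rfl
    rw [h2]
    split_ifs
    · rw [negOneNormFun_zero, zero_pow two_ne_zero]
    · rw [negOneNormFun_const_mul (norm_wedgeSign k K)]
  rw [negOneNormSq, negOneNormSq, Finset.sum_congr rfl fun K _ => h1 K,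
    ← sum_wedge_eq_sum_contract k fun _ J => negOneNormFun Ω (fun z => u z J) ^ 2]
  refine Finset.sum_le_sum fun J _ => ?_
  split_ifs
  · exact le_rfl
  · exact sq_nonneg _

/-- The pointwise norm of the form on the left hand side of condition (ii) does not increase when
`u` is replaced by its contractions. -/
theorem sum_norm_sq_coeffCons_le (q : ℕ) (hq : 1 ≤ q) (c : Fin n → Fin n → ℂ) (a : FormVal n) :
    ∑ K : Finset (Fin n) with K.card = q, ‖∑ j, ∑ k, c j k * conj (coeffCons a k K)‖ ^ 2 ≤
      ∑ m, ∑ K : Finset (Fin n) with K.card = q - 1,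
        ‖∑ j, ∑ k, c j k * conj (coeffCons (contractOp m a) k K)‖ ^ 2 := by
  -- Antisymmetry: moving `m` out of `K` past `k` changes `u_{kK}` by a sign independent of `k`,
  -- which factors out of the sum.
  have key : ∀ (m : Fin n) (K : Finset (Fin n)), m ∈ K →
      ‖∑ j, ∑ k, c j k * conj (coeffCons a k K)‖ =
      ‖∑ j, ∑ k, c j k * conj (coeffCons (contractOp m a) k (K.erase m))‖ := by
    intro m K hm
    have h1 : ∀ k, coeffCons (contractOp m a) k (K.erase m) =
        -wedgeSign m (K.erase m) * coeffCons a k K := by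
      intro k
      change contractOp k (contractOp m a) (K.erase m) = _ * contractOp k a K
      rw [contractOp_contractOp, PiLp.neg_apply, contractOp_apply m, if_neg (by simp),
        Finset.insert_erase hm, neg_mul]
    have h2 : ∑ j, ∑ k, c j k * conj (coeffCons (contractOp m a) k (K.erase m)) =
        -wedgeSign m (K.erase m) * ∑ j, ∑ k, c j k * conj (coeffCons a k K) := by
      simp_rw [h1, map_mul, map_neg, conj_wedgeSign, Finset.mul_sum, mul_left_comm]
    rw [h2, norm_mul, norm_neg, norm_wedgeSign, one_mul]
  have h1 : ∀ K : Finset (Fin n), (if K.card = q then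
      ‖∑ j, ∑ k, c j k * conj (coeffCons a k K)‖ ^ 2 else 0) ≤
      ∑ m, if m ∈ K then (if K.card = q then
        ‖∑ j, ∑ k, c j k * conj (coeffCons (contractOp m a) k (K.erase m))‖ ^ 2 else 0) else 0 := by
    intro K
    split_ifs with hK
    -- `q ≥ 1` is essential here: there must be an index of `K` to contract with.
    · obtain ⟨m, hm⟩ : K.Nonempty := Finset.card_pos.1 (by omega)
      refine le_trans (le_of_eq ?_) (Finset.single_le_sum (fun i _ => ?_) (Finset.mem_univ m))
      · rw [if_pos hm, key m K hm]
      · split_ifs <;> positivity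
    · simp
  rw [Finset.sum_filter]
  refine (Finset.sum_le_sum fun K _ => h1 K).trans ?_
  rw [Finset.sum_comm]
  refine Finset.sum_le_sum fun m _ => ?_
  rw [sum_wedge_eq_sum_contract m fun K J => if J.card = q then
    ‖∑ j, ∑ k, c j k * conj (coeffCons (contractOp m a) k K)‖ ^ 2 else 0, Finset.sum_filter]
  refine Finset.sum_le_sum fun K _ => ?_
  by_cases hm : m ∈ K
  · rw [if_pos hm]
    split_ifs <;> positivity
  · rw [if_neg hm, Finset.card_insert_of_notMem hm]
    split_ifs with h2 h3 h3
    · exact le_rfl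
    · omega
    · positivity
    · exact le_rfl

/-- Defining functions are smooth only near the closure of `Ω`; the global ones agree with them
there and give a continuous integrand. -/
theorem integrable_hessianTerm (hΩ : IsOpen Ω) (hb : Bornology.IsBounded Ω) {ρ ρε : Cn n → ℝ}
    (hρ : IsDefiningFunction Ω ρ) (hρε : IsDefiningFunction Ω ρε) (q : ℕ) {u : Cn n → FormVal n}
    (hu : Continuous u) :
    Integrable (fun z => ∑ K : Finset (Fin n) with K.card = q,
      ‖∑ j, ∑ k, complexHessian ρε j k z * dzbar j (toComplex ρ) z *
        conj (coeffCons (u z) k K)‖ ^ 2) (volume.restrict Ω) := by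
  obtain ⟨r, hr, hrr⟩ := hρ.exists_global
  obtain ⟨s, hs, hss⟩ := hρε.exists_global
  have h1 : ∀ j, Continuous (dzbar j (toComplex r)) := fun j =>
    (ContDiff.dzbar (m := ∞) (by simpa using hr.contDiff_toComplex) j).continuous
  have h2 : ∀ j k, Continuous (complexHessian s j k) := fun j k =>
    (ContDiff.dz (m := ∞) (by simpa using
      (ContDiff.dzbar (m := ∞) (by simpa using hs.contDiff_toComplex) k)) j).continuous
  have h3 : ∀ k K, Continuous fun z => coeffCons (u z) k K := fun k K =>
    (EuclideanSpace.proj K : FormVal n →L[ℂ] ℂ).continuous.comp ((contractOp k).continuous.comp hu)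
  have h4 : Continuous fun z => ∑ K : Finset (Fin n) with K.card = q,
      ‖∑ j, ∑ k, complexHessian s j k z * dzbar j (toComplex r) z *
        conj (coeffCons (u z) k K)‖ ^ 2 :=
    continuous_finsetSum _ fun K _ => (continuous_finsetSum _ fun j _ =>
      continuous_finsetSum _ fun k _ => ((h2 j k).mul (h1 j)).mul
        (Complex.continuous_conj.comp (h3 k K))).norm.pow 2
  refine (Continuous.integrable_restrict_of_isBounded hb h4).congr ?_
  filter_upwards [ae_restrict_mem hΩ.measurableSet] with z hz
  have e1 := hrr z (subset_closure hz)
  have e2 := hss z (subset_closure hz)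
  simp_rw [e1.toComplex.dzbar_eq, e2.complexHessian_eq]

theorem hessianTermSq_succ_le (hΩ : IsOpen Ω) (hb : Bornology.IsBounded Ω) {ρ ρε : Cn n → ℝ}
    (hρ : IsDefiningFunction Ω ρ) (hρε : IsDefiningFunction Ω ρε) {q : ℕ} (hq : 1 ≤ q)
    {u : Cn n → FormVal n} (hu : Continuous u) :
    hessianTermSq Ω ρ ρε (q + 1) u ≤ ∑ m, hessianTermSq Ω ρ ρε q (contraction m u) := by
  have hi := fun m : Fin n => integrable_hessianTerm hΩ hb hρ hρε (q - 1)
    (u := contraction m u) ((contractOp m).continuous.comp hu)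
  unfold hessianTermSq
  rw [← integral_finsetSum _ fun m _ => hi m, Nat.add_sub_cancel]
  refine integral_mono (integrable_hessianTerm hΩ hb hρ hρε q hu)
    (integrable_finsetSum _ fun m _ => hi m) fun z => ?_
  exact sum_norm_sq_coeffCons_le q hq
    (fun j k => complexHessian ρε j k z * dzbar j (toComplex ρ) z) (u z)

/-- Condition (ii) at level `q` implies condition (ii) at level `q + 1`. -/
theorem IsSmoothBoundedPseudoconvexDomain.exists_hessianEstimate_succ
    (hΩ : IsSmoothBoundedPseudoconvexDomain Ω) {ρ : Cn n → ℝ} (hρ : IsDefiningFunction Ω ρ)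
    {q : ℕ} (hq : 1 ≤ q) :
    ∃ A : ℝ, 0 < A ∧ ∀ (ρε : Cn n → ℝ) (ε Cε : ℝ), 0 < ε → IsDefiningFunction Ω ρε →
      HessianEstimate Ω ρ ρε q (ε / A) Cε → ∃ Cε' : ℝ, HessianEstimate Ω ρ ρε (q + 1) ε Cε' := by
  obtain ⟨B, hB⟩ := hΩ.exists_contraction_bound q
  have hA : 0 < n * (|B| + 1) + 1 := by positivity
  -- There are `n` contractions, each with energy at most `|B| + 1` times that of `u`; the final `1`
  -- keeps `A` positive. The absolute value of `Cε` is needed because its sign is not prescribed.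
  refine ⟨n * (|B| + 1) + 1, hA, fun ρε ε Cε hε hρε h =>
    ⟨n * |Cε|, fun u U hu hU => ?_⟩⟩
  set A : ℝ := n * (|B| + 1) + 1
  set X : ℝ := l2NormSq Ω (smoothDbar u) + ‖dbarStar Ω U‖ ^ 2 with hX
  have hl : 0 ≤ l2NormSq Ω (smoothDbar u) := integral_nonneg fun z => sq_nonneg _
  have hX0 : 0 ≤ X := add_nonneg hl (sq_nonneg _)
  have hm : ∀ m, hessianTermSq Ω ρ ρε q (contraction m u) ≤
      ε / A * ((|B| + 1) * X) + |Cε| * negOneNormSq Ω u := by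
    intro m
    obtain ⟨hv, V, hV, h1, h2⟩ := hB u U hu hU m
    refine (h _ V hv hV).trans (add_le_add (mul_le_mul_of_nonneg_left ?_ (by positivity)) ?_)
    · have h3 : ‖dbarStar Ω V‖ ^ 2 ≤ X :=
        (pow_le_pow_left₀ (norm_nonneg _) h1 2).trans (le_add_of_nonneg_left hl)
      have h4 : B * X ≤ |B| * X := mul_le_mul_of_nonneg_right (le_abs_self B) hX0
      linarith
    · exact mul_le_mul (le_abs_self _) (negOneNormSq_contraction_le u m) (negOneNormSq_nonneg _)
        (abs_nonneg _)
  have h5 := (hessianTermSq_succ_le hΩ.isOpen hΩ.isBounded hρ hρε hq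
    hu.contDiff.continuous).trans (Finset.sum_le_sum fun m _ => hm m)
  rw [Finset.sum_const, Finset.card_univ, Fintype.card_fin, nsmul_eq_mul] at h5
  have h6 : ε / A * (n * (|B| + 1)) ≤ ε := by
    rw [div_mul_eq_mul_div, div_le_iff₀ hA]
    exact mul_le_mul_of_nonneg_left (le_add_of_nonneg_right zero_le_one) hε.le
  have h7 := mul_le_mul_of_nonneg_right h6 hX0
  linarith

end Contraction

/-! ### The theorem -/

theorem mainTheorem3 {n : ℕ} (Ω : Set (Cn n)) (hΩ : IsSmoothBoundedPseudoconvexDomain Ω)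
    (ρ : Cn n → ℝ) (hρ : IsDefiningFunction Ω ρ) (q : ℕ) (hq : 1 ≤ q) (hqn : q + 1 ≤ n) :
    (SufficientCondition Ω ρ q → SufficientCondition Ω ρ (q + 1)) ∧
    (∃ A : ℝ, 0 < A ∧ ∀ (C : ℝ) (ρfam : ℝ → Cn n → ℝ), FamilySatisfies Ω ρ q C ρfam →
      FamilySatisfies Ω ρ (q + 1) C (fun ε => ρfam (ε / A))) ∧
    (∃ B : ℝ, ∀ (u : Cn n → FormVal n) (U : (dbarStar Ω).domain),
      IsSmoothForm (q + 1) u → Represents Ω u U → ∀ k : Fin n,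
        IsSmoothForm q (contraction k u) ∧
        ∃ V : (dbarStar Ω).domain, Represents Ω (contraction k u) V ∧
          ‖dbarStar Ω V‖ ≤ ‖dbarStar Ω U‖ ∧
          l2NormSq Ω (smoothDbar (contraction k u)) ≤
            B * (l2NormSq Ω (smoothDbar u) + ‖dbarStar Ω U‖ ^ 2)) := by
  obtain ⟨A, hA, h⟩ := hΩ.exists_hessianEstimate_succ hρ hq
  refine ⟨?_, ⟨A, hA, ?_⟩, hΩ.exists_contraction_bound q⟩
  · rintro ⟨C, hC⟩
    refine ⟨C, fun ε hε => ?_⟩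
    -- The function chosen for `ε / A` serves `ε` one level up; the gradient bound does not involve
    -- `q`, so `C` is unchanged.
    obtain ⟨ρε, Cε, h1, h2, h3⟩ := hC (ε / A) (div_pos hε hA)
    obtain ⟨Cε', h4⟩ := h ρε ε Cε hε h1 h3
    exact ⟨ρε, Cε', h1, h2, h4⟩
  · intro C ρfam hfam ε hε
    obtain ⟨h1, h2, Cε, h3⟩ := hfam (ε / A) (div_pos hε hA)
    exact ⟨h1, h2, h _ ε Cε hε h1 h3⟩
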